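/- Fix integers $d,m\ge 0$. Multi-indices $\alpha=(\alpha_1,\dots,\alpha_\ell)$ have letters in $\{1,\dots,d\}$ and length $|\alpha|=\ell$, and the order of the letters is disregarded (so $\alpha$ indexes a monomial in $d$ commuting variables). For a path $w=(w_1,\dots,w_d)\colon[0,1]\to\mathbb R^d$ write $w_\alpha(t)=w_{\alpha_1}(t)\cdots w_{\alpha_\ell}(t)$, $w_\emptyset(t)=1$. For $f\colon[0,1]\to\mathbb R$ let $\|f\|_{L^\infty}=\sup_{t\in[0,1]}|f(t)|$ and let $\|f\|_{\mathrm{Lip}}$ be the smallest Lipschitz constant of $f$ on $[0,1]$. There is a family $(\Omega_\varepsilon)_{\varepsilon\in(0,1]}$ of measurable sets of paths $[0,1]\to\mathbb R^d$ (measurable for the product $\sigma$-algebra), depending only on $d$ and $m$, with the following two properties. (i) For every $p>0$ there is a constant $C$ such that, for every standard $d$-dimensional Wiener process $W$ (on any probability space) and every $\varepsilon\in(0,1]$, $\mathbb P\bigl(W|_{[0,1]}\in\Omega_\varepsilon\bigr)\le C\varepsilon^p$. (ii) For every $\varepsilon\in(0,1]$, every continuous path $w\notin\Omega_\varepsilon$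 and every family $(A_\alpha)_{|\alpha|\le m}$ of Lipschitz continuous functions $[0,1]\to\mathbb R$, the function $Z(t)=\sum_{|\alpha|\le m}A_\alpha(t)\,w_\alpha(t)$ satisfies $$\|Z\|_{L^\infty}\le\varepsilon\quad\Longrightarrow\quad \sup_{|\alpha|\le m}\|A_\alpha\|_{L^\infty}\le\varepsilon^{3^{-m}}\quad\text{or}\quad \sup_{|\alpha|\le m}\|A_\alpha\|_{\mathrm{Lip}}\ge\varepsilon^{-3^{-(m+1)}}.$$ In particular, the exceptional event $\{W|_{[0,1]}\in\Omega_\varepsilon\}$ is the same for all coefficient processes $A_\alpha$, which may be random and need not be adapted to the filtration of $W$. -/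

import Mathlib

open MeasureTheory ProbabilityTheory
open scoped NNReal ENNReal

/-- A standard `d`-dimensional Wiener process: `d` independent real Brownian motions
(each one starting from `0` and with almost surely continuous paths). -/
structure IsWienerProcess {Ω : Type*} [MeasurableSpace Ω] {d : ℕ}
    (W : Fin d → ℝ≥0 → Ω → ℝ) (P : Measure Ω) : Prop where
  isBrownianReal : ∀ i, IsBrownianReal (W i) P
  indep : iIndepFun (fun (i : Fin d) (ω : Ω) (t : ℝ≥0) => W i t ω) P

/-- Multi-indices `α = (α₁, …, αₗ)` with letters in `{1, …, d}` and of length `|α| = ℓ ≤ m`.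
They index monomials `W_α = W_{α₁} ⋯ W_{αₗ}` in commuting variables, so the order of the letters
is disregarded. -/
abbrev MultiIndex (d m : ℕ) : Type := {α : Multiset (Fin d) // α.card ≤ m}

instance MultiIndex.instFinite (d m : ℕ) : Finite (MultiIndex d m) := by
  let f : MultiIndex d m → (Fin d → Fin (m + 1)) :=
    fun α i => ⟨α.1.count i, Nat.lt_succ_of_le ((Multiset.count_le_card i α.1).trans α.2)⟩
  refine Finite.of_injective f fun α β h => Subtype.ext (Multiset.ext.2 fun i => ?_)
  exact congrArg Fin.val (congrFun h i)

noncomputable instance MultiIndex.instFintype (d m : ℕ) : Fintype (MultiIndex d m) :=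
  Fintype.ofFinite _

/-- The monomial `w_α(t) = w_{α₁}(t) ⋯ w_{αₗ}(t)` of a path `w`, with `w_∅(t) = 1`. -/
def pathMonomial {d : ℕ} (w : Fin d → unitInterval → ℝ) (α : Multiset (Fin d)) (t : unitInterval) : ℝ :=
  (α.map fun i => w i t).prod

/-- The Wiener polynomial `Z(t) = ∑_{|α| ≤ m} A_α(t) w_α(t)`, `t ∈ [0, 1]`. -/
noncomputable def wienerPolynomial {d m : ℕ} (w : Fin d → unitInterval → ℝ) (A : MultiIndex d m → unitInterval → ℝ)
    (t : unitInterval) : ℝ :=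
  ∑ α : MultiIndex d m, A α t * pathMonomial w α.1 t

/-- The supremum norm over the time interval `[0, 1]`. -/
noncomputable def supNorm (f : unitInterval → ℝ) : ℝ≥0∞ := ⨆ t : unitInterval, ‖f t‖ₑ

/-- The Lipschitz seminorm on `[0, 1]`: the smallest Lipschitz constant, `∞` if there is none. -/
noncomputable def lipNorm (f : unitInterval → ℝ) : ℝ≥0∞ := eHolderNorm 1 f

/-- The restriction to the time interval `[0, 1]` of the path `t ↦ W(t, ω)`. -/
def pathOn {Ω : Type*} {d : ℕ} (W : Fin d → ℝ≥0 → Ω → ℝ) (ω : Ω) : Fin d → unitInterval → ℝ :=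
  fun i t => W i (unitInterval.toNNReal t) ω

/-!
The proof is by induction on the degree, and rests on one gain per derivative: if
`Z(t) = ∑ A_α(t) w_α(t)` is of size `ε ^ e` and the `A_α` and their Lipschitz constants are at most
`ε ^ (-lam)`, then each formal derivative `∂ᵢZ`, a Wiener polynomial of one degree less, is of size
`ε ^ ((e - lam) / 2 - κ)` for every `κ > 0`, unless the path is exceptional
(`exists_isNegligible_derivCoeff_le`).

For this, expand `Z` to first order in the path around a time `t`, over a time interval of length
`h = ε ^ (e + lam)` (`abs_wienerPolynomial_taylor_le`). Freezing the coefficients costs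
`ε ^ (-lam) h = ε ^ e`, and for a path that is almost `1 / 2`-Hölder the second-order terms cost
about as much, so that `|∇Z(t) · Δw|` is at most about `ε ^ e` for all increments `Δw` inside the
interval. A nondegenerate Brownian path has, in every direction, an increment of size about
`√h` there, whence `|∇Z(t)| ≲ ε ^ e / √h = ε ^ ((e - lam) / 2)`.

The exceptional paths are thus of two kinds. Those that are too rough, `roughPaths`, are
controlled by Gaussian moments of dyadic increments, and chaining (`DyadicBound.abs_sub_le`) turns
the dyadic bound into a modulus of continuity. Those that are degenerate on some block, in some
direction, `degeneratePaths`, are controlled by a union bound over polynomially many blocks and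
over a finite net of directions: the projection on a unit vector is a Brownian motion
(`IsWienerProcess.isPreBrownianReal_sum`), and its `2 ^ r ≥ ε ^ (-κ)` increments inside a block are
independent, each one being small with probability at most `1 / 2`. Both families depend on the
path only, not on the coefficients, and have probability `O(ε ^ p)` for all `p` (`IsNegligible`).

Each derivative replaces `e + lam` by `(e + lam) / 2`, so the coefficients are of size `ε ^ μ` for
every `μ < (e + lam) / 2 ^ m - lam` (`exists_isNegligible_coeff_le`). For `e = 1` and
`lam = 3 ^ (-(m + 1))` the choice `μ = 3 ^ (-m)` is allowed as soon as `m ≥ 1`, with a margin that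
absorbs all constants and small powers of `ε`; degree `0` is trivial. Large coefficients are
reduced to bounded ones by scaling (`abs_coeff_le_of_scaling`).
-/

/-! ### Dyadic chaining -/

/-- The left end `⌊2ⁿ s⌋ / 2ⁿ` of the dyadic interval of generation `n` that contains `s`. -/
noncomputable def dyadicFloor (n : ℕ) (s : ℝ) : ℝ := (⌊2 ^ n * s⌋₊ : ℝ) / 2 ^ n

lemma dyadicFloor_le {s : ℝ} (hs : 0 ≤ s) (n : ℕ) : dyadicFloor n s ≤ s := by
  rw [dyadicFloor, div_le_iff₀' (by positivity)]
  exact Nat.floor_le (by positivity)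

lemma lt_dyadicFloor_add (s : ℝ) (n : ℕ) : s < dyadicFloor n s + (1 / 2) ^ n := by
  have h := Nat.lt_floor_add_one (2 ^ n * s)
  have h2 : (0 : ℝ) < 2 ^ n := by positivity
  rw [dyadicFloor, one_div, inv_pow, ← one_div, ← add_div, lt_div_iff₀' h2]
  exact h

lemma tendsto_dyadicFloor {s : ℝ} (hs : 0 ≤ s) :
    Filter.Tendsto (fun n => dyadicFloor n s) Filter.atTop (nhds s) := by
  have h0 : Filter.Tendsto (fun n : ℕ => s - (1 / 2 : ℝ) ^ n) Filter.atTop (nhds (s - 0)) :=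
    (tendsto_pow_atTop_nhds_zero_of_lt_one (by norm_num) (by norm_num)).const_sub s
  rw [sub_zero] at h0
  exact tendsto_of_tendsto_of_tendsto_of_le_of_le h0 tendsto_const_nhds
    (fun n => by simpa using (sub_lt_iff_lt_add.2 (lt_dyadicFloor_add s n)).le)
    (fun n => dyadicFloor_le hs n)

/-- All dyadic increments of `f` over `[0, 1]` decay geometrically with the generation. -/
def DyadicBound (f : ℝ → ℝ) (K ρ : ℝ) : Prop :=
  ∀ n k : ℕ, k < 2 ^ n → |f ((k + 1 : ℕ) / 2 ^ n) - f (k / 2 ^ n)| ≤ K * ρ ^ n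

lemma DyadicBound.abs_sub_floor_succ {f : ℝ → ℝ} {K ρ : ℝ} (hf : DyadicBound f K ρ)
    (hK : 0 ≤ K) (hρ : 0 ≤ ρ) {s : ℝ} (hs : 0 ≤ s) (hs1 : s ≤ 1) (n : ℕ) :
    |f (dyadicFloor (n + 1) s) - f (dyadicFloor n s)| ≤ K * ρ ^ (n + 1) := by
  set k := ⌊2 ^ n * s⌋₊ with hk
  have hx : (0 : ℝ) ≤ 2 ^ n * s := by positivity
  have h1 : (k : ℝ) ≤ 2 ^ n * s := Nat.floor_le hx
  have h2 : 2 ^ n * s < k + 1 := Nat.lt_floor_add_one _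
  have hfl : dyadicFloor n s = ((2 * k : ℕ) : ℝ) / 2 ^ (n + 1) := by
    rw [dyadicFloor, ← hk, pow_succ]; push_cast; field_simp
  have hcase : ⌊(2 : ℝ) ^ (n + 1) * s⌋₊ = 2 * k ∨ ⌊(2 : ℝ) ^ (n + 1) * s⌋₊ = 2 * k + 1 := by
    have e1 : 2 * k ≤ ⌊(2 : ℝ) ^ (n + 1) * s⌋₊ := by
      apply Nat.le_floor; rw [pow_succ]; push_cast; linarith
    have e2 : ⌊(2 : ℝ) ^ (n + 1) * s⌋₊ < 2 * k + 2 := by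
      rw [Nat.floor_lt (by positivity), pow_succ]; push_cast; linarith
    omega
  rcases hcase with h | h
  · rw [hfl, dyadicFloor, h, sub_self, abs_zero]; positivity
  · have hlt : 2 * k < 2 ^ (n + 1) := by
      have : (⌊(2 : ℝ) ^ (n + 1) * s⌋₊ : ℝ) ≤ 2 ^ (n + 1) :=
        (Nat.floor_le (by positivity)).trans (mul_le_of_le_one_right (by positivity) hs1)
      rw [h] at this
      have : 2 * k + 1 ≤ 2 ^ (n + 1) := by exact_mod_cast this
      omega
    rw [hfl, dyadicFloor, h]
    exact hf (n + 1) (2 * k) hlt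

lemma DyadicBound.abs_sub_floor {f : ℝ → ℝ} {K ρ : ℝ} (hf : DyadicBound f K ρ)
    (hK : 0 ≤ K) (hρ : 0 ≤ ρ) (hρ1 : ρ < 1) (hc : Continuous f) {s : ℝ} (hs : 0 ≤ s)
    (hs1 : s ≤ 1) (n : ℕ) : |f s - f (dyadicFloor n s)| ≤ K * ρ ^ n / (1 - ρ) := by
  have h1 : 0 < 1 - ρ := by linarith
  have key : ∀ m, |f (dyadicFloor (n + m) s) - f (dyadicFloor n s)|
      ≤ K * (ρ ^ n - ρ ^ (n + m)) / (1 - ρ) := by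
    intro m
    induction m with
    | zero => simp
    | succ m ih =>
      have h := hf.abs_sub_floor_succ hK hρ hs hs1 (n + m)
      have h3 : K * (ρ ^ n - ρ ^ (n + (m + 1))) / (1 - ρ)
          = K * (ρ ^ n - ρ ^ (n + m)) / (1 - ρ) + K * ρ ^ (n + m) := by
        field_simp; ring
      have h4 : K * ρ ^ (n + m + 1) ≤ K * ρ ^ (n + m) :=
        mul_le_mul_of_nonneg_left (pow_le_pow_of_le_one hρ hρ1.le (Nat.le_succ _)) hK
      rw [h3]
      calc _ ≤ |f (dyadicFloor (n + m + 1) s) - f (dyadicFloor (n + m) s)|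
            + |f (dyadicFloor (n + m) s) - f (dyadicFloor n s)| := abs_sub_le _ _ _
        _ ≤ _ := by linarith
  have hlim : Filter.Tendsto (fun m => |f (dyadicFloor (m + n) s) - f (dyadicFloor n s)|)
      Filter.atTop (nhds |f s - f (dyadicFloor n s)|) :=
    (((hc.tendsto s).comp ((Filter.tendsto_add_atTop_iff_nat n).2
      (tendsto_dyadicFloor hs))).sub_const _).abs
  refine le_of_tendsto hlim (Filter.Eventually.of_forall fun m => ?_)
  rw [add_comm m n]
  refine (key m).trans ?_
  gcongr
  linarith [pow_nonneg hρ (n + m)]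

/-- Chaining: a continuous function with geometrically small dyadic increments has the
corresponding modulus of continuity at dyadic scales. -/
lemma DyadicBound.abs_sub_le {f : ℝ → ℝ} {K ρ : ℝ} (hf : DyadicBound f K ρ)
    (hK : 0 ≤ K) (hρ : 0 ≤ ρ) (hρ1 : ρ < 1) (hc : Continuous f) {s t : ℝ} (hs : 0 ≤ s)
    (hs1 : s ≤ 1) (ht : 0 ≤ t) (ht1 : t ≤ 1) (n : ℕ) (hst : |s - t| ≤ (1 / 2) ^ n) :
    |f s - f t| ≤ 3 / (1 - ρ) * (K * ρ ^ n) := by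
  wlog hle : s ≤ t generalizing s t
  · rw [abs_sub_comm]
    exact this ht ht1 hs hs1 (by rwa [abs_sub_comm]) (le_of_not_ge hle)
  have h1 : 0 < 1 - ρ := by linarith
  have hp : (0 : ℝ) < 2 ^ n := by positivity
  have a1 := hf.abs_sub_floor hK hρ hρ1 hc hs hs1 n
  have a2 := hf.abs_sub_floor hK hρ hρ1 hc ht ht1 n
  have hmid : |f (dyadicFloor n t) - f (dyadicFloor n s)| ≤ K * ρ ^ n := by
    have b1 : ⌊(2 : ℝ) ^ n * s⌋₊ ≤ ⌊(2 : ℝ) ^ n * t⌋₊ := Nat.floor_mono (by gcongr)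
    have b2 : ⌊(2 : ℝ) ^ n * t⌋₊ ≤ ⌊(2 : ℝ) ^ n * s⌋₊ + 1 := by
      rw [← Nat.floor_add_one (by positivity)]
      apply Nat.floor_mono
      have : t - s ≤ (1 / 2) ^ n := by rw [abs_sub_comm] at hst; exact (le_abs_self _).trans hst
      rw [one_div, inv_pow, ← one_div, le_div_iff₀' hp] at this
      linarith
    have hcase : ⌊(2 : ℝ) ^ n * t⌋₊ = ⌊(2 : ℝ) ^ n * s⌋₊ ∨
        ⌊(2 : ℝ) ^ n * t⌋₊ = ⌊(2 : ℝ) ^ n * s⌋₊ + 1 := by omega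
    rcases hcase with h | h
    · rw [dyadicFloor, dyadicFloor, h, sub_self, abs_zero]; positivity
    · rw [dyadicFloor, dyadicFloor, h]
      apply hf
      have : (⌊(2 : ℝ) ^ n * t⌋₊ : ℝ) ≤ 2 ^ n :=
        (Nat.floor_le (by positivity)).trans (mul_le_of_le_one_right (by positivity) ht1)
      rw [h] at this
      have : ⌊(2 : ℝ) ^ n * s⌋₊ + 1 ≤ 2 ^ n := by exact_mod_cast this
      omega
  have h4 : K * ρ ^ n ≤ K * ρ ^ n / (1 - ρ) := by
    rw [le_div_iff₀ h1]
    exact mul_le_of_le_one_right (by positivity) (by linarith)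
  have h5 : 3 / (1 - ρ) * (K * ρ ^ n) = 3 * (K * ρ ^ n / (1 - ρ)) := by ring
  rw [h5]
  rw [abs_le] at *
  constructor <;> linarith [a1.1, a1.2, a2.1, a2.2, hmid.1, hmid.2]

/-! ### Monomials: Lipschitz and second-order Taylor estimates -/

section Monomials
variable {d : ℕ}

/-- The formal partial derivative `∂ᵢ x^α` of a monomial in commuting variables. -/
noncomputable def monomialDeriv (x : Fin d → ℝ) (i : Fin d) (α : Multiset (Fin d)) : ℝ :=
  α.count i * ((α.erase i).map x).prod

lemma monomialDeriv_cons (x : Fin d → ℝ) (i j : Fin d) (α : Multiset (Fin d)) :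
    monomialDeriv x i (j ::ₘ α)
      = (if i = j then (α.map x).prod else 0) + x j * monomialDeriv x i α := by
  unfold monomialDeriv
  rcases eq_or_ne i j with rfl | h
  · rw [Multiset.count_cons_self, Multiset.erase_cons_head, if_pos rfl]
    by_cases hi : i ∈ α
    · conv_lhs => rw [← Multiset.cons_erase hi]
      conv_rhs => rw [← Multiset.cons_erase hi]
      simp only [Multiset.map_cons, Multiset.prod_cons, Multiset.count_cons_self,
        Multiset.erase_cons_head]
      push_cast; ring
    · rw [Multiset.count_eq_zero_of_notMem hi]; simp
  · rw [Multiset.count_cons_of_ne h, Multiset.erase_cons_tail α h.symm, if_neg h,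
      Multiset.map_cons, Multiset.prod_cons]
    ring

lemma sum_monomialDeriv_cons (x v : Fin d → ℝ) (j : Fin d) (α : Multiset (Fin d)) :
    ∑ i, monomialDeriv x i (j ::ₘ α) * v i
      = v j * (α.map x).prod + x j * ∑ i, monomialDeriv x i α * v i := by
  simp only [monomialDeriv_cons, add_mul, Finset.sum_add_distrib, ite_mul, zero_mul,
    Finset.sum_ite_eq', Finset.mem_univ, if_true, Finset.mul_sum]
  congr 1
  · ring
  · exact Finset.sum_congr rfl fun i _ => by ring

variable {x y : Fin d → ℝ} {K ω : ℝ}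

lemma abs_monomial_le (hK : 1 ≤ K) (hx : ∀ i, |x i| ≤ K) {m : ℕ} (α : Multiset (Fin d))
    (hα : α.card ≤ m) : |(α.map x).prod| ≤ K ^ m := by
  refine le_trans ?_ (pow_le_pow_right₀ hK hα)
  clear hα
  induction α using Multiset.induction_on with
  | empty => simp
  | cons j α ih =>
    rw [Multiset.map_cons, Multiset.prod_cons, abs_mul, Multiset.card_cons, pow_succ']
    exact mul_le_mul (hx j) ih (abs_nonneg _) (by linarith)

lemma abs_monomial_sub_le (hK : 1 ≤ K) (hx : ∀ i, |x i| ≤ K) (hy : ∀ i, |y i| ≤ K)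
    (hω : ∀ i, |x i - y i| ≤ ω) (hω0 : 0 ≤ ω) (α : Multiset (Fin d)) :
    |(α.map x).prod - (α.map y).prod| ≤ α.card * K ^ α.card * ω := by
  induction α using Multiset.induction_on with
  | empty => simp
  | cons j α ih =>
    rw [Multiset.map_cons, Multiset.prod_cons, Multiset.map_cons, Multiset.prod_cons,
      Multiset.card_cons]
    have h1 := abs_monomial_le hK hx α le_rfl
    have e : x j * (α.map x).prod - y j * (α.map y).prod
      = (x j - y j) * (α.map x).prod + y j * ((α.map x).prod - (α.map y).prod) := by ring
    rw [e]
    have hp : K ^ α.card ≤ K ^ (α.card + 1) := pow_le_pow_right₀ hK (Nat.le_succ _)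
    calc _ ≤ |x j - y j| * |(α.map x).prod| + |y j| * |(α.map x).prod - (α.map y).prod| := by
            rw [← abs_mul, ← abs_mul]; exact abs_add_le _ _
      _ ≤ ω * K ^ α.card + K * (α.card * K ^ α.card * ω) := by
            gcongr
            · exact hω j
            · exact hy j
      _ ≤ ω * K ^ (α.card + 1) + K * (α.card * K ^ α.card * ω) := by gcongr
      _ = _ := by push_cast; ring

/-- Second-order Taylor estimate for a monomial. -/
lemma abs_monomial_taylor_le (hK : 1 ≤ K) (hx : ∀ i, |x i| ≤ K) (hy : ∀ i, |y i| ≤ K)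
    (hω : ∀ i, |x i - y i| ≤ ω) (hω0 : 0 ≤ ω) {m : ℕ} (α : Multiset (Fin d)) (hα : α.card ≤ m) :
    |(α.map x).prod - (α.map y).prod - ∑ i, monomialDeriv y i α * (x i - y i)|
      ≤ m ^ 2 * K ^ m * ω ^ 2 := by
  suffices h : |(α.map x).prod - (α.map y).prod - ∑ i, monomialDeriv y i α * (x i - y i)|
      ≤ α.card ^ 2 * K ^ α.card * ω ^ 2 by
    refine h.trans ?_
    have := pow_le_pow_right₀ hK hα
    gcongr
  clear hα
  induction α using Multiset.induction_on with
  | empty => simp [monomialDeriv]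
  | cons j α ih =>
    have h1 := abs_monomial_sub_le hK hx hy hω hω0 α
    rw [sum_monomialDeriv_cons y (fun i => x i - y i), Multiset.map_cons, Multiset.prod_cons,
      Multiset.map_cons, Multiset.prod_cons, Multiset.card_cons]
    set S := ∑ i, monomialDeriv y i α * (x i - y i)
    have e : x j * (α.map x).prod - y j * (α.map y).prod
        - ((x j - y j) * (α.map y).prod + y j * S)
      = (x j - y j) * ((α.map x).prod - (α.map y).prod)
        + y j * ((α.map x).prod - (α.map y).prod - S) := by ring
    rw [e]
    have hp : K ^ α.card ≤ K ^ (α.card + 1) := pow_le_pow_right₀ hK (Nat.le_succ _)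
    have hc : (0 : ℝ) ≤ α.card := Nat.cast_nonneg _
    calc _ ≤ |x j - y j| * |(α.map x).prod - (α.map y).prod|
          + |y j| * |(α.map x).prod - (α.map y).prod - S| := by
            rw [← abs_mul, ← abs_mul]; exact abs_add_le _ _
      _ ≤ ω * (α.card * K ^ α.card * ω) + K * (α.card ^ 2 * K ^ α.card * ω ^ 2) := by
            gcongr
            · exact hω j
            · exact hy j
      _ ≤ ω * (α.card * K ^ (α.card + 1) * ω) + K * (α.card ^ 2 * K ^ α.card * ω ^ 2) := by gcongr
      _ = (α.card ^ 2 + α.card) * (K ^ (α.card + 1) * ω ^ 2) := by ring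
      _ ≤ (α.card + 1) ^ 2 * (K ^ (α.card + 1) * ω ^ 2) := by
            gcongr; nlinarith
      _ = _ := by push_cast; ring

end Monomials

/-! ### Derivatives of Wiener polynomials -/

section Derivative
variable {d m : ℕ}

/-- The coefficients of the formal partial derivative, in the `i`-th path variable, of the
polynomial with coefficients `A`. -/
noncomputable def derivCoeff (A : MultiIndex d (m + 1) → unitInterval → ℝ) (i : Fin d) :
    MultiIndex d m → unitInterval → ℝ := fun β t =>
  (β.1.count i + 1) * A ⟨i ::ₘ β.1, by rw [Multiset.card_cons]; exact Nat.succ_le_succ β.2⟩ t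

lemma wienerPolynomial_derivCoeff (w : Fin d → unitInterval → ℝ)
    (A : MultiIndex d (m + 1) → unitInterval → ℝ) (i : Fin d) (t : unitInterval) :
    wienerPolynomial w (derivCoeff A i) t
      = ∑ α : MultiIndex d (m + 1), A α t * monomialDeriv (fun j => w j t) i α.1 := by
  refine Fintype.sum_of_injective
    (fun β : MultiIndex d m => (⟨i ::ₘ β.1, by
      rw [Multiset.card_cons]; exact Nat.succ_le_succ β.2⟩ : MultiIndex d (m + 1))) ?_ _ _ ?_ ?_
  · intro β γ h
    exact Subtype.ext ((Multiset.cons_inj_right i).1 (congrArg Subtype.val h))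
  · intro α hα
    have : i ∉ α.1 := by
      intro hi
      refine hα ⟨⟨α.1.erase i, ?_⟩, Subtype.ext (Multiset.cons_erase hi)⟩
      rw [Multiset.card_erase_of_mem hi]
      have := α.2
      exact Nat.pred_le_iff.2 this
    simp [monomialDeriv, Multiset.count_eq_zero_of_notMem this]
  · intro β
    simp only [derivCoeff, pathMonomial, monomialDeriv, Multiset.count_cons_self,
      Multiset.erase_cons_head]
    push_cast; ring

lemma abs_derivCoeff_le {A : MultiIndex d (m + 1) → unitInterval → ℝ} {L : ℝ}
    (hA : ∀ α t, |A α t| ≤ L) (i : Fin d) (β : MultiIndex d m) (t : unitInterval) :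
    |derivCoeff A i β t| ≤ (m + 1) * L := by
  rw [derivCoeff, abs_mul, abs_of_nonneg (by positivity)]
  have h : (β.1.count i : ℝ) ≤ m := by
    exact_mod_cast (Multiset.count_le_card i β.1).trans β.2
  gcongr
  exact hA _ _

lemma abs_derivCoeff_sub_le {A : MultiIndex d (m + 1) → unitInterval → ℝ} {L : ℝ}
    (hA : ∀ α (s t : unitInterval), |A α s - A α t| ≤ L * |(s : ℝ) - t|) (i : Fin d)
    (β : MultiIndex d m) (s t : unitInterval) :
    |derivCoeff A i β s - derivCoeff A i β t| ≤ (m + 1) * L * |(s : ℝ) - t| := by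
  rw [derivCoeff, derivCoeff, ← mul_sub, abs_mul, abs_of_nonneg (by positivity), mul_assoc]
  have h : (β.1.count i : ℝ) ≤ m := by
    exact_mod_cast (Multiset.count_le_card i β.1).trans β.2
  gcongr
  exact hA _ _ _

/-- First-order expansion of a Wiener polynomial at time `t`: the error is linear in the time
increment (from the coefficients) and quadratic in the increment of the path. -/
lemma abs_wienerPolynomial_taylor_le (w : Fin d → unitInterval → ℝ)
    (A : MultiIndex d (m + 1) → unitInterval → ℝ) {L K ω : ℝ} {s t : unitInterval}
    (hK : 1 ≤ K) (hL : 0 ≤ L) (hw : ∀ i u, |w i u| ≤ K) (hω0 : 0 ≤ ω)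
    (hω : ∀ i, |w i s - w i t| ≤ ω) (hA : ∀ α t, |A α t| ≤ L)
    (hA' : ∀ α (s t : unitInterval), |A α s - A α t| ≤ L * |(s : ℝ) - t|) :
    |wienerPolynomial w A s - wienerPolynomial w A t
        - ∑ i, wienerPolynomial w (derivCoeff A i) t * (w i s - w i t)|
      ≤ Fintype.card (MultiIndex d (m + 1)) *
        (L * K ^ (m + 1) * (|(s : ℝ) - t| + (m + 1) ^ 2 * ω ^ 2)) := by
  have e : wienerPolynomial w A s - wienerPolynomial w A t
        - ∑ i, wienerPolynomial w (derivCoeff A i) t * (w i s - w i t)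
      = ∑ α : MultiIndex d (m + 1), ((A α s - A α t) * pathMonomial w α.1 s
        + A α t * (pathMonomial w α.1 s - pathMonomial w α.1 t
          - ∑ i, monomialDeriv (fun j => w j t) i α.1 * (w i s - w i t))) := by
    simp only [wienerPolynomial_derivCoeff, Finset.sum_mul]
    rw [Finset.sum_comm, wienerPolynomial, wienerPolynomial, ← Finset.sum_sub_distrib,
      ← Finset.sum_sub_distrib]
    refine Finset.sum_congr rfl fun α _ => ?_
    simp only [mul_sub, Finset.mul_sum, sub_mul, Finset.sum_sub_distrib]
    simp only [mul_assoc]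
    ring
  rw [e, ← nsmul_eq_mul]
  refine (Finset.abs_sum_le_sum_abs _ _).trans (Finset.sum_le_card_nsmul _ _ _ fun α _ => ?_)
  have h1 := abs_monomial_le hK (fun i => hw i s) α.1 α.2
  have h2 := abs_monomial_taylor_le hK (fun i => hw i s) (fun i => hw i t) hω hω0 α.1 α.2
  calc _ ≤ |A α s - A α t| * |pathMonomial w α.1 s| + |A α t| * |pathMonomial w α.1 s
            - pathMonomial w α.1 t
            - ∑ i, monomialDeriv (fun j => w j t) i α.1 * (w i s - w i t)| := by
          rw [← abs_mul, ← abs_mul]; exact abs_add_le _ _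
    _ ≤ L * |(s : ℝ) - t| * K ^ (m + 1) + L * ((m + 1 : ℕ) ^ 2 * K ^ (m + 1) * ω ^ 2) := by
          gcongr
          · exact hA' α s t
          · exact h1
          · exact hA α t
          · exact h2
    _ = _ := by push_cast; ring

end Derivative

/-! ### The two exceptional events -/

section Events
variable {d : ℕ}

/-- A path on `[0, 1]` extended to the real line by its end values. -/
noncomputable def extendPath (f : unitInterval → ℝ) (x : ℝ) : ℝ :=
  f (Set.projIcc 0 1 zero_le_one x)

lemma extendPath_coe (f : unitInterval → ℝ) (t : unitInterval) : extendPath f t = f t := by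
  rw [extendPath, Set.projIcc_val]

lemma continuous_extendPath {f : unitInterval → ℝ} (hf : Continuous f) :
    Continuous (extendPath f) :=
  hf.comp continuous_projIcc

lemma measurable_extendPath_apply (i : Fin d) (x : ℝ) :
    Measurable fun w : Fin d → unitInterval → ℝ => extendPath (w i) x :=
  (measurable_pi_apply _).comp (measurable_pi_apply i)

/-- The paths that do not start at `0` or have a dyadic increment exceeding `K ρⁿ` in some
generation `n`. -/
def roughPaths (d : ℕ) (K ρ : ℝ) : Set (Fin d → unitInterval → ℝ) :=
  {w | ∃ i, extendPath (w i) 0 ≠ 0 ∨ ∃ n k : ℕ, k < 2 ^ n ∧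
    K * ρ ^ n < |extendPath (w i) ((k + 1 : ℕ) / 2 ^ n) - extendPath (w i) (k / 2 ^ n)|}

lemma measurableSet_roughPaths (K ρ : ℝ) : MeasurableSet (roughPaths d K ρ) := by
  have e : roughPaths d K ρ = ⋃ i, ({w | extendPath (w i) 0 ≠ 0} ∪ ⋃ n : ℕ, ⋃ k : ℕ,
      ⋃ _ : k < 2 ^ n, {w | K * ρ ^ n < |extendPath (w i) ((k + 1 : ℕ) / 2 ^ n)
        - extendPath (w i) (k / 2 ^ n)|}) := by
    ext w; simp [roughPaths]
  rw [e]
  refine MeasurableSet.iUnion fun i => MeasurableSet.union ?_ (MeasurableSet.iUnion fun n =>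
    MeasurableSet.iUnion fun k => MeasurableSet.iUnion fun _ => ?_)
  · exact ((measurable_extendPath_apply i 0) (measurableSet_singleton 0)).compl
  · exact measurableSet_lt measurable_const
      ((measurable_extendPath_apply i _).sub (measurable_extendPath_apply i _)).abs

lemma abs_sub_le_of_notMem_roughPaths {K ρ : ℝ} (hK : 0 ≤ K) (hρ : 0 ≤ ρ) (hρ1 : ρ < 1)
    {w : Fin d → unitInterval → ℝ} (hw : ∀ i, Continuous (w i)) (h : w ∉ roughPaths d K ρ)
    (i : Fin d) (s t : unitInterval) (n : ℕ) (hst : |(s : ℝ) - t| ≤ (1 / 2) ^ n) :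
    |w i s - w i t| ≤ 3 / (1 - ρ) * (K * ρ ^ n) := by
  have hD : DyadicBound (extendPath (w i)) K ρ := by
    intro n k hk
    by_contra hc
    exact h ⟨i, Or.inr ⟨n, k, hk, not_le.1 hc⟩⟩
  have := hD.abs_sub_le hK hρ hρ1 (continuous_extendPath (hw i)) s.2.1 s.2.2 t.2.1 t.2.2 n hst
  rwa [extendPath_coe, extendPath_coe] at this

lemma abs_le_of_notMem_roughPaths {K ρ : ℝ} (hK : 0 ≤ K) (hρ : 0 ≤ ρ) (hρ1 : ρ < 1)
    {w : Fin d → unitInterval → ℝ} (hw : ∀ i, Continuous (w i)) (h : w ∉ roughPaths d K ρ)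
    (i : Fin d) (t : unitInterval) : |w i t| ≤ 3 / (1 - ρ) * K := by
  have h0 : w i 0 = 0 := by
    by_contra hc
    refine h ⟨i, Or.inl ?_⟩
    have := extendPath_coe (w i) 0
    rw [Set.Icc.coe_zero] at this
    rwa [this]
  have := abs_sub_le_of_notMem_roughPaths hK hρ hρ1 hw h i t 0 0
    (by simpa [abs_of_nonneg t.2.1] using t.2.2)
  simpa [h0] using this

/-- The integer vectors of sup-norm exactly `M`: scaled by `1 / M` they form a net of the unit
sphere for the sup-norm. -/
noncomputable def latticeSphere (d M : ℕ) : Finset (Fin d → ℤ) :=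
  (Fintype.piFinset fun _ => Finset.Icc (-(M : ℤ)) M).filter fun l => ∃ i, |l i| = M

/-- The increment of `w` in direction `l / M` over the `j`-th of the intervals of length
`2 ^ (-(q + r))` that divide the `k`-th interval of length `2 ^ (-q)`. -/
noncomputable def directionalIncrement (q r : ℕ) (b : Fin d → ℝ) (k j : ℕ)
    (w : Fin d → unitInterval → ℝ) : ℝ :=
  ∑ i, b i * (extendPath (w i) ((k * 2 ^ r + (j + 1) : ℕ) / 2 ^ (q + r))
    - extendPath (w i) ((k * 2 ^ r + j : ℕ) / 2 ^ (q + r)))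

/-- The paths that, on some dyadic interval of length `2 ^ (-q)` and in some direction of the net,
have all their `2 ^ r` increments small compared with the Brownian scale. -/
def degeneratePaths (d q r M : ℕ) : Set (Fin d → unitInterval → ℝ) :=
  {w | ∃ k < 2 ^ q, ∃ l ∈ latticeSphere d M, ∀ j < 2 ^ r,
    |directionalIncrement q r (fun i => (l i : ℝ) / M) k j w| ≤ √((1 / 2) ^ (q + r)) / 2}

lemma measurable_directionalIncrement (q r : ℕ) (b : Fin d → ℝ) (k j : ℕ) :
    Measurable (directionalIncrement q r b k j) :=
  Finset.measurable_sum _ fun i _ =>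
    ((measurable_extendPath_apply i _).sub (measurable_extendPath_apply i _)).const_mul _

lemma measurableSet_degeneratePaths (q r M : ℕ) : MeasurableSet (degeneratePaths d q r M) := by
  have e : degeneratePaths d q r M = ⋃ k : ℕ, ⋃ _ : k < 2 ^ q, ⋃ l ∈ latticeSphere d M,
      ⋂ j : ℕ, ⋂ _ : j < 2 ^ r,
      {w | |directionalIncrement q r (fun i => (l i : ℝ) / M) k j w|
        ≤ √((1 / 2) ^ (q + r)) / 2} := by
    ext w; simp [degeneratePaths]
  rw [e]
  refine MeasurableSet.iUnion fun k => MeasurableSet.iUnion fun _ =>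
    Finset.measurableSet_biUnion _ fun l _ => MeasurableSet.iInter fun j =>
    MeasurableSet.iInter fun _ => ?_
  exact measurableSet_le (measurable_directionalIncrement q r _ k j).abs measurable_const

/-- Every vector of sup-norm `1` is within `1 / M` of the net: rounding `M b` down keeps the
coordinates equal to `±M`. -/
lemma exists_latticeSphere_near {M : ℕ} (hM : 0 < M) (b : Fin d → ℝ) (hb : ∀ i, |b i| ≤ 1)
    (i₀ : Fin d) (hi₀ : |b i₀| = 1) :
    ∃ l ∈ latticeSphere d M, ∀ i, |b i - (l i : ℝ) / M| ≤ 1 / M := by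
  have hM' : (0 : ℝ) < M := by exact_mod_cast hM
  refine ⟨fun i => ⌊M * b i⌋, ?_, fun i => ?_⟩
  · rw [latticeSphere, Finset.mem_filter, Fintype.mem_piFinset]
    refine ⟨fun i => ?_, i₀, ?_⟩
    · have := abs_le.1 (hb i)
      rw [Finset.mem_Icc]
      constructor
      · rw [Int.le_floor]; push_cast; nlinarith
      · have h1 : (⌊(M : ℝ) * b i⌋ : ℝ) ≤ M := (Int.floor_le _).trans (by nlinarith)
        exact_mod_cast h1
    · rcases eq_or_eq_neg_of_abs_eq hi₀ with h | h
      · simp [h]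
      · have : (M : ℝ) * -1 = ((-(M : ℤ) : ℤ) : ℝ) := by push_cast; ring
        simp only [h, this, Int.floor_intCast, abs_neg, Nat.abs_cast]
  · have h1 := Int.floor_le ((M : ℝ) * b i)
    have h2 := Int.lt_floor_add_one ((M : ℝ) * b i)
    have e : b i - (⌊(M : ℝ) * b i⌋ : ℝ) / M = (M * b i - ⌊(M : ℝ) * b i⌋) / M := by field_simp
    rw [e, abs_of_nonneg (div_nonneg (by linarith) hM'.le)]
    gcongr
    linarith

lemma directionalIncrement_smul (q r : ℕ) (c : ℝ) (b : Fin d → ℝ) (k j : ℕ)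
    (w : Fin d → unitInterval → ℝ) : directionalIncrement q r (fun i => c * b i) k j w
      = c * directionalIncrement q r b k j w := by
  simp only [directionalIncrement, Finset.mul_sum, mul_assoc]

lemma abs_directionalIncrement_sub_le {q r k j : ℕ} {w : Fin d → unitInterval → ℝ} {ω η : ℝ}
    (hω : ∀ i, |extendPath (w i) ((k * 2 ^ r + (j + 1) : ℕ) / 2 ^ (q + r))
      - extendPath (w i) ((k * 2 ^ r + j : ℕ) / 2 ^ (q + r))| ≤ ω) (hη : 0 ≤ η)
    {b c : Fin d → ℝ} (hbc : ∀ i, |b i - c i| ≤ η) :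
    |directionalIncrement q r b k j w - directionalIncrement q r c k j w| ≤ d * (η * ω) := by
  rw [directionalIncrement, directionalIncrement, ← Finset.sum_sub_distrib]
  refine (Finset.abs_sum_le_sum_abs _ _).trans ?_
  have : (d : ℝ) * (η * ω) = (Finset.univ : Finset (Fin d)).card • (η * ω) := by simp
  rw [this]
  refine Finset.sum_le_card_nsmul _ _ _ fun i _ => ?_
  rw [← sub_mul, abs_mul]
  exact mul_le_mul (hbc i) (hω i) (abs_nonneg _) hη

/-- Outside the degenerate paths, a vector is controlled by its pairings with the small
increments of the path over any dyadic interval of length `2 ^ (-q)`. -/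
lemma abs_le_of_notMem_degeneratePaths {q r M k : ℕ} {w : Fin d → unitInterval → ℝ}
    (hw : w ∉ degeneratePaths d q r M) (hM : 0 < M) (hk : k < 2 ^ q) {ω c : ℝ}
    (hω : ∀ i, ∀ j < 2 ^ r, |extendPath (w i) ((k * 2 ^ r + (j + 1) : ℕ) / 2 ^ (q + r))
      - extendPath (w i) ((k * 2 ^ r + j : ℕ) / 2 ^ (q + r))| ≤ ω)
    (hωM : 4 * d * ω / M ≤ √((1 / 2) ^ (q + r))) (a : Fin d → ℝ)
    (ha : ∀ j < 2 ^ r, |directionalIncrement q r a k j w| ≤ c) (i : Fin d) :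
    |a i| * √((1 / 2) ^ (q + r)) ≤ 4 * c := by
  have hM' : (0 : ℝ) < M := by exact_mod_cast hM
  obtain ⟨i₀, -, hi₀⟩ := Finset.exists_max_image Finset.univ (fun i => |a i|) ⟨i, Finset.mem_univ i⟩
  have hmax : ∀ i, |a i| ≤ |a i₀| := fun i => hi₀ i (Finset.mem_univ i)
  refine le_trans (mul_le_mul_of_nonneg_right (hmax i) (Real.sqrt_nonneg _)) ?_
  rcases (abs_nonneg (a i₀)).eq_or_lt with h0 | h0
  · rw [← h0, zero_mul]
    have := (abs_nonneg _).trans (ha 0 (by positivity))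
    linarith
  set b : Fin d → ℝ := fun i => |a i₀|⁻¹ * a i with hb
  obtain ⟨l, hl, hbl⟩ := exists_latticeSphere_near hM b
    (fun i => by
      simp only [hb, abs_mul, abs_inv, abs_abs]
      rw [inv_mul_le_iff₀ h0, mul_one]; exact hmax i) i₀
    (by simp only [hb, abs_mul, abs_inv, abs_abs]; exact inv_mul_cancel₀ h0.ne')
  have hex : ∃ j < 2 ^ r, √((1 / 2) ^ (q + r)) / 2
      < |directionalIncrement q r (fun i => (l i : ℝ) / M) k j w| := by
    by_contra hcon
    push Not at hcon
    exact hw ⟨k, hk, l, hl, hcon⟩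
  obtain ⟨j, hj, hlt⟩ := hex
  have h1 := abs_directionalIncrement_sub_le (fun i => hω i j hj) (by positivity) hbl
  have h2 := ha j hj
  have h3 : directionalIncrement q r b k j w = |a i₀|⁻¹ * directionalIncrement q r a k j w :=
    directionalIncrement_smul q r _ a k j w
  have h4 : (d : ℝ) * (1 / M * ω) ≤ √((1 / 2) ^ (q + r)) / 4 := by
    have : (d : ℝ) * (1 / M * ω) = 4 * d * ω / M / 4 := by ring
    rw [this]; linarith
  have h5 : √((1 / 2) ^ (q + r)) / 4 ≤ |directionalIncrement q r b k j w| := by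
    have := abs_sub_abs_le_abs_sub (directionalIncrement q r (fun i => (l i : ℝ) / M) k j w)
      (directionalIncrement q r b k j w)
    rw [abs_sub_comm] at this
    linarith
  rw [h3, abs_mul, abs_inv, abs_abs, le_inv_mul_iff₀ h0] at h5
  linarith

end Events

/-! ### Smallness of a Wiener polynomial passes to its derivatives -/

lemma exists_dyadic_block (q : ℕ) {t : ℝ} (ht : 0 ≤ t) (ht1 : t ≤ 1) :
    ∃ k : ℕ, k < 2 ^ q ∧ (k : ℝ) ≤ 2 ^ q * t ∧ 2 ^ q * t ≤ k + 1 := by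
  have hp : (0 : ℝ) < 2 ^ q := by positivity
  rcases ht1.eq_or_lt with rfl | h
  · refine ⟨2 ^ q - 1, Nat.sub_lt (by positivity) one_pos, ?_, ?_⟩ <;>
      rw [Nat.cast_sub Nat.one_le_two_pow] <;> push_cast <;> linarith
  · refine ⟨⌊2 ^ q * t⌋₊, ?_, Nat.floor_le (by positivity), (Nat.lt_floor_add_one _).le⟩
    rw [Nat.floor_lt (by positivity)]
    push_cast
    nlinarith

/-- The points of the partition of the `k`-th dyadic block stay in `[0, 1]`, close to any point
of the block. -/
lemma dyadic_point_mem {q r k j : ℕ} (hk : k < 2 ^ q) (hj : j ≤ 2 ^ r) {t : ℝ}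
    (h1 : (k : ℝ) ≤ 2 ^ q * t) (h2 : 2 ^ q * t ≤ k + 1) :
    ((k * 2 ^ r + j : ℕ) : ℝ) / 2 ^ (q + r) ∈ Set.Icc (0 : ℝ) 1 ∧
      |((k * 2 ^ r + j : ℕ) : ℝ) / 2 ^ (q + r) - t| ≤ (1 / 2) ^ q := by
  have hq : (0 : ℝ) < 2 ^ q := by positivity
  have hr : (0 : ℝ) < 2 ^ r := by positivity
  have hj' : (j : ℝ) ≤ 2 ^ r := by exact_mod_cast hj
  have hk' : (k : ℝ) + 1 ≤ 2 ^ q := by exact_mod_cast hk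
  have e : ((k * 2 ^ r + j : ℕ) : ℝ) / 2 ^ (q + r) = (k + j / 2 ^ r) / 2 ^ q := by
    rw [pow_add]; push_cast; field_simp
  have hjr : (j : ℝ) / 2 ^ r ≤ 1 := (div_le_one hr).2 hj'
  have hjr0 : 0 ≤ (j : ℝ) / 2 ^ r := by positivity
  rw [e]
  refine ⟨⟨by positivity, (div_le_one hq).2 (by linarith)⟩, ?_⟩
  have e2 : ((k : ℝ) + j / 2 ^ r) / 2 ^ q - t = (k + j / 2 ^ r - 2 ^ q * t) / 2 ^ q := by
    field_simp
  rw [e2, abs_div, abs_of_pos hq, one_div, inv_pow, ← one_div]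
  gcongr
  rw [abs_le]
  constructor <;> linarith

/-- If a Wiener polynomial is small then so are its formal derivatives: the first-order expansion
around `t` makes all pairings of the gradient with nearby increments of the path small, and the
path is not degenerate. -/
lemma abs_wienerPolynomial_derivCoeff_le {d m q r M : ℕ} {w : Fin d → unitInterval → ℝ}
    {A : MultiIndex d (m + 1) → unitInterval → ℝ} {L K η ω ω' : ℝ}
    (hdeg : w ∉ degeneratePaths d q r M) (hM : 0 < M)
    (hK : 1 ≤ K) (hL : 0 ≤ L) (hw : ∀ i u, |w i u| ≤ K) (hω0 : 0 ≤ ω)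
    (hω : ∀ i (s t : unitInterval), |(s : ℝ) - t| ≤ (1 / 2) ^ q → |w i s - w i t| ≤ ω)
    (hω' : ∀ i (s t : unitInterval), |(s : ℝ) - t| ≤ (1 / 2) ^ (q + r) → |w i s - w i t| ≤ ω')
    (hωM : 4 * d * ω' / M ≤ √((1 / 2) ^ (q + r)))
    (hA : ∀ α t, |A α t| ≤ L)
    (hA' : ∀ α (s t : unitInterval), |A α s - A α t| ≤ L * |(s : ℝ) - t|)
    (hZ : ∀ t, |wienerPolynomial w A t| ≤ η) (i : Fin d) (t : unitInterval) :
    |wienerPolynomial w (derivCoeff A i) t| * √((1 / 2) ^ (q + r)) ≤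
      8 * (2 * η + Fintype.card (MultiIndex d (m + 1)) *
        (L * K ^ (m + 1) * ((1 / 2) ^ q + (m + 1) ^ 2 * ω ^ 2))) := by
  obtain ⟨k, hk, hk1, hk2⟩ := exists_dyadic_block q t.2.1 t.2.2
  set R := Fintype.card (MultiIndex d (m + 1)) *
        (L * K ^ (m + 1) * ((1 / 2) ^ q + (m + 1) ^ 2 * ω ^ 2)) with hR
  have hpair : ∀ j ≤ 2 ^ r, |∑ i, wienerPolynomial w (derivCoeff A i) t *
      (extendPath (w i) ((k * 2 ^ r + j : ℕ) / 2 ^ (q + r)) - w i t)| ≤ 2 * η + R := by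
    intro j hj
    obtain ⟨hmem, hdist⟩ := dyadic_point_mem hk hj hk1 hk2
    set s : unitInterval := ⟨_, hmem⟩ with hs
    have hext : ∀ i, extendPath (w i) ((k * 2 ^ r + j : ℕ) / 2 ^ (q + r)) = w i s :=
      fun i => extendPath_coe (w i) s
    simp only [hext]
    have h := abs_wienerPolynomial_taylor_le (s := s) (t := t) w A hK hL hw hω0
      (fun i => hω i s t hdist) hA hA'
    have h' : Fintype.card (MultiIndex d (m + 1)) *
        (L * K ^ (m + 1) * (|(s : ℝ) - t| + (m + 1) ^ 2 * ω ^ 2)) ≤ R := by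
      rw [hR]
      have : |(s : ℝ) - t| ≤ (1 / 2) ^ q := hdist
      gcongr
    have h1 := abs_le.1 (hZ s)
    have h2 := abs_le.1 (hZ t)
    have h3 := abs_le.1 (h.trans h')
    rw [abs_le]
    constructor <;> linarith [h1.1, h1.2, h2.1, h2.2, h3.1, h3.2]
  have hmain := abs_le_of_notMem_degeneratePaths (c := 2 * (2 * η + R)) (ω := ω') hdeg hM hk ?_ hωM
    (fun i => wienerPolynomial w (derivCoeff A i) t) ?_ i
  · linarith
  · intro i j hj
    obtain ⟨hmem, -⟩ := dyadic_point_mem (r := r) (j := j + 1) hk hj hk1 hk2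
    obtain ⟨hmem', -⟩ := dyadic_point_mem (r := r) (j := j) hk hj.le hk1 hk2
    have e1 := extendPath_coe (w i) ⟨_, hmem⟩
    have e2 := extendPath_coe (w i) ⟨_, hmem'⟩
    rw [e1, e2]
    refine hω' i _ _ (le_of_eq ?_)
    have hp : (0 : ℝ) < 2 ^ (q + r) := by positivity
    have e3 : ((k * 2 ^ r + (j + 1) : ℕ) : ℝ) / 2 ^ (q + r)
      - ((k * 2 ^ r + j : ℕ) : ℝ) / 2 ^ (q + r) = (1 / 2) ^ (q + r) := by
      rw [← sub_div, one_div, inv_pow, ← one_div]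
      congr 1
      push_cast; ring
    simp only [e3]
    exact abs_of_pos (by positivity)
  · intro j hj
    have h1 := abs_le.1 (hpair (j + 1) hj)
    have h2 := abs_le.1 (hpair j hj.le)
    have e : directionalIncrement q r (fun i => wienerPolynomial w (derivCoeff A i) t) k j w
        = ∑ i, wienerPolynomial w (derivCoeff A i) t *
            (extendPath (w i) ((k * 2 ^ r + (j + 1) : ℕ) / 2 ^ (q + r)) - w i t)
          - ∑ i, wienerPolynomial w (derivCoeff A i) t *
            (extendPath (w i) ((k * 2 ^ r + j : ℕ) / 2 ^ (q + r)) - w i t) := by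
      rw [← Finset.sum_sub_distrib]
      exact Finset.sum_congr rfl fun i _ => by ring
    rw [e, abs_le]
    constructor <;> linarith [h1.1, h1.2, h2.1, h2.2]

/-! ### Gaussian and Brownian estimates -/

lemma exists_gaussianReal_tail_le (Q : ℕ) : ∃ C : ℝ, 0 ≤ C ∧ ∀ (v : ℝ≥0) (x : ℝ), 0 < x →
    gaussianReal 0 v {y | x < |y|} ≤ ENNReal.ofReal (C * (√v / x) ^ Q) := by
  have hfin : ∫⁻ y, ENNReal.ofReal (|y| ^ Q) ∂(gaussianReal 0 1) ≠ ∞ := by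
    have h : Integrable (fun y : ℝ => ‖y‖ ^ Q) (gaussianReal 0 1) :=
      (memLp_id_gaussianReal (μ := 0) (v := 1) (Q : ℝ≥0)).integrable_norm_pow'
    rw [← lt_top_iff_ne_top]
    refine lt_of_eq_of_lt ?_ h.2
    refine lintegral_congr fun y => ?_
    have hy : 0 ≤ ‖y‖ ^ Q := by positivity
    rw [Real.enorm_eq_ofReal hy, Real.norm_eq_abs]
  refine ⟨(∫⁻ y, ENNReal.ofReal (|y| ^ Q) ∂(gaussianReal 0 1)).toReal, ENNReal.toReal_nonneg,
    fun v x hx => ?_⟩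
  have hmap : gaussianReal 0 v = (gaussianReal 0 1).map (fun y => √v * y) := by
    rw [gaussianReal_map_const_mul]
    congr 1
    · simp
    · ext; simp
  rw [hmap, Measure.map_apply (by fun_prop)
    (measurableSet_lt measurable_const (by fun_prop)), mul_comm,
    ENNReal.ofReal_mul (by positivity), ENNReal.ofReal_toReal hfin]
  have hsub : (fun y => √v * y) ⁻¹' {y | x < |y|}
      ⊆ {y | 1 ≤ ENNReal.ofReal ((√v / x) ^ Q) * ENNReal.ofReal (|y| ^ Q)} := by
    intro y hy
    simp only [Set.mem_preimage, Set.mem_ofPred_eq, abs_mul, abs_of_nonneg (Real.sqrt_nonneg _)]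
      at hy
    rw [Set.mem_ofPred_eq, ← ENNReal.ofReal_mul (by positivity), ← mul_pow, ENNReal.one_le_ofReal]
    apply one_le_pow₀
    rw [div_mul_eq_mul_div, one_le_div hx]
    exact hy.le
  refine (measure_mono hsub).trans ?_
  have h := mul_meas_ge_le_lintegral (μ := gaussianReal 0 1)
    (f := fun y => ENNReal.ofReal ((√v / x) ^ Q) * ENNReal.ofReal (|y| ^ Q)) (by fun_prop) 1
  rwa [one_mul, lintegral_const_mul _ (by fun_prop)] at h

lemma gaussianReal_small_ball_le {v : ℝ≥0} (hv : v ≠ 0) :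
    gaussianReal 0 v {y | |y| ≤ √v / 2} ≤ 1 / 2 := by
  have hv0 : (0 : ℝ) < v := by positivity
  have hs : 0 < √(v : ℝ) := Real.sqrt_pos.2 hv0
  have hset : {y : ℝ | |y| ≤ √v / 2} = Set.Icc (-(√v / 2)) (√v / 2) := by
    ext y; simp [abs_le]
  have hpdf : ∀ y, gaussianPDF 0 v y ≤ ENNReal.ofReal (1 / (2 * √v)) := by
    intro y
    rw [gaussianPDF, gaussianPDFReal_def]
    apply ENNReal.ofReal_le_ofReal
    have h1 : 2 * √v ≤ √(2 * Real.pi * v) := by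
      apply Real.le_sqrt_of_sq_le
      rw [mul_pow, Real.sq_sqrt hv0.le]
      nlinarith [Real.pi_gt_three]
    have h2 : Real.exp (-(y - 0) ^ 2 / (2 * v)) ≤ 1 := by
      rw [Real.exp_le_one_iff]
      apply div_nonpos_of_nonpos_of_nonneg
      · nlinarith [sq_nonneg (y - 0)]
      · positivity
    calc (√(2 * Real.pi * v))⁻¹ * Real.exp (-(y - 0) ^ 2 / (2 * v))
        ≤ (√(2 * Real.pi * v))⁻¹ * 1 := by gcongr
      _ ≤ 1 / (2 * √v) := by rw [mul_one, one_div]; gcongr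
  rw [gaussianReal_apply _ hv, hset]
  calc ∫⁻ y in Set.Icc (-(√v / 2)) (√v / 2), gaussianPDF 0 v y
      ≤ ∫⁻ _ in Set.Icc (-(√v / 2)) (√v / 2), ENNReal.ofReal (1 / (2 * √v)) :=
        lintegral_mono fun y => hpdf y
    _ = ENNReal.ofReal (1 / (2 * √v)) * ENNReal.ofReal (√v) := by
        rw [setLIntegral_const, Real.volume_Icc]; congr 2; ring
    _ = ENNReal.ofReal (1 / 2) := by
        rw [← ENNReal.ofReal_mul (by positivity)]; congr 1; field_simp
    _ = 1 / 2 := by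
        rw [ENNReal.ofReal_div_of_pos (by norm_num)]; simp

section Brownian
variable {Ω : Type*} [MeasurableSpace Ω] {P : Measure Ω}

/-- A Brownian motion is unlikely to have all its increments over a partition of mesh `δ` below
`√δ / 2`. -/
lemma measure_small_increments_le {B : ℝ≥0 → Ω → ℝ} (hB : IsPreBrownianReal B P) {s : ℕ → ℝ≥0}
    {δ : ℝ≥0} (hδ : δ ≠ 0) (hs : ∀ j, s (j + 1) = s j + δ) (n : ℕ) :
    P {ω | ∀ j < n, |B (s (j + 1)) ω - B (s j) ω| ≤ √δ / 2} ≤ (1 / 2) ^ n := by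
  have hmono : Monotone s := monotone_nat_of_le_succ fun j => by rw [hs]; exact le_self_add
  have hind := hB.hasIndepIncrements.nat hmono
  have hmeas : MeasurableSet {y : ℝ | |y| ≤ √δ / 2} :=
    measurableSet_le (by fun_prop) measurable_const
  have e : {ω | ∀ j < n, |B (s (j + 1)) ω - B (s j) ω| ≤ √δ / 2}
      = ⋂ j ∈ Finset.range n, (fun ω => B (s (j + 1)) ω - B (s j) ω) ⁻¹' {y | |y| ≤ √δ / 2} := by
    ext ω; simp
  rw [e, hind.measure_inter_preimage_eq_mul (Finset.range n) (fun _ _ => hmeas)]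
  rw [← Finset.card_range n, ← Finset.prod_const, Finset.card_range]
  refine Finset.prod_le_prod' fun j _ => ?_
  have hlaw := hB.hasLaw_sub (s (j + 1)) (s j)
  have hv : nndist (s (j + 1)).1 (s j).1 = δ := by
    ext
    rw [coe_nndist, Real.dist_eq]
    have : (s (j + 1)).1 - (s j).1 = δ := by
      have := congrArg NNReal.toReal (hs j)
      rw [NNReal.coe_add] at this
      simp only [NNReal.val_eq_coe]
      linarith
    rw [this]; simp
  rw [hv] at hlaw
  have := hlaw.measure_eq (p := fun y => |y| ≤ √δ / 2) hmeas
  exact this.trans_le (gaussianReal_small_ball_le hδ)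

/-- The projection of a Wiener process on a Euclidean unit vector is a Brownian motion. -/
lemma IsWienerProcess.isPreBrownianReal_sum {d : ℕ} {W : Fin d → ℝ≥0 → Ω → ℝ}
    [IsProbabilityMeasure P] (hW : IsWienerProcess W P) {b : Fin d → ℝ} (hb : ∑ i, b i ^ 2 = 1) :
    IsPreBrownianReal (fun t ω => ∑ i, b i * W i t ω) P := by
  have hG : ∀ i t, HasGaussianLaw (W i t) P := fun i t =>
    ((hW.isBrownianReal i).hasLaw_eval t).hasGaussianLaw
  have hL : ∀ i t, MemLp (fun ω => b i * W i t ω) 2 P := fun i t =>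
    (hG i t).memLp_two.const_mul (b i)
  refine IsGaussianProcess.isPreBrownianReal_of_covariance ⟨fun I => ?_⟩ (fun t => ?_)
    (fun s t hst => ?_)
  · have hind : iIndepFun (fun (i : Fin d) (ω : Ω) => b i • (I.restrict fun x => W i x ω)) P :=
      hW.indep.comp (fun i f => b i • I.restrict f) fun i => by fun_prop
    have := iIndepFun.hasGaussianLaw_fun_sum
      (fun i => ((hW.isBrownianReal i).hasLaw I).hasGaussianLaw.fun_smul (b i)) hind
    have e : (fun ω => I.restrict fun t => ∑ i, b i * W i t ω)
        = fun ω => ∑ i, b i • (I.restrict fun x => W i x ω) := by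
      ext ω x; simp
    rw [e]
    exact this
  · rw [integral_finsetSum _ fun i _ => ((hG i t).integrable.const_mul _)]
    refine Finset.sum_eq_zero fun i _ => ?_
    rw [integral_const_mul, (hW.isBrownianReal i).integral_eval, mul_zero]
  · rw [covariance_fun_sum_fun_sum (fun i => hL i s) (fun i => hL i t)]
    have : ∀ i j, cov[fun ω => b i * W i s ω, fun ω => b j * W j t ω; P]
        = if i = j then b i ^ 2 * s else 0 := by
      intro i j
      rw [covariance_const_mul_left, covariance_const_mul_right]
      split_ifs with hij
      · subst hij
        rw [(hW.isBrownianReal i).covariance_fun_eval, min_eq_left hst]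
        ring
      · have hI : IndepFun (W i s) (W j t) P :=
          (hW.indep.indepFun hij).comp (measurable_pi_apply s) (measurable_pi_apply t)
        have := hI.covariance_eq_zero (hG i s).memLp_two (hG j t).memLp_two
        change b i * (b j * cov[W i s, W j t; P]) = 0
        rw [this]; ring
    simp only [this, Finset.sum_ite_eq, Finset.mem_univ, if_true]
    rw [← Finset.sum_mul, hb, one_mul]

end Brownian

/-! ### Negligible families of events -/

/-- A family of measurable sets of paths, indexed by `ε`, whose probability under the Wiener
process is `O(ε ^ p)` for every `p`, uniformly over the probability spaces carrying a Wiener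
process. -/
def IsNegligible.{u} {d : ℕ} (N : ℝ → Set (Fin d → unitInterval → ℝ)) : Prop :=
  (∀ ε, MeasurableSet (N ε)) ∧
  ∀ p : ℝ, 0 < p → ∃ C : ℝ, ∀ (Ω : Type u) [MeasurableSpace Ω] (P : Measure Ω)
    [IsProbabilityMeasure P] (W : Fin d → ℝ≥0 → Ω → ℝ), IsWienerProcess W P →
      ∀ ε : ℝ, 0 < ε → ε ≤ 1 → P {ω | pathOn W ω ∈ N ε} ≤ ENNReal.ofReal (C * ε ^ p)

section Negligible
universe u
variable {d : ℕ}

lemma IsNegligible.union {N N' : ℝ → Set (Fin d → unitInterval → ℝ)} (h : IsNegligible.{u} N)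
    (h' : IsNegligible.{u} N') : IsNegligible.{u} fun ε => N ε ∪ N' ε := by
  refine ⟨fun ε => (h.1 ε).union (h'.1 ε), fun p hp => ?_⟩
  obtain ⟨C, hC⟩ := h.2 p hp
  obtain ⟨C', hC'⟩ := h'.2 p hp
  refine ⟨max C 0 + max C' 0, fun Ω _ P _ W hW ε hε hε1 => ?_⟩
  have hpos : 0 ≤ ε ^ p := Real.rpow_nonneg hε.le p
  have e : {ω | pathOn W ω ∈ N ε ∪ N' ε} = {ω | pathOn W ω ∈ N ε} ∪ {ω | pathOn W ω ∈ N' ε} := rfl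
  rw [e, add_mul, ENNReal.ofReal_add (by positivity) (by positivity)]
  refine (measure_union_le _ _).trans (add_le_add ?_ ?_)
  · exact (hC Ω P W hW ε hε hε1).trans (ENNReal.ofReal_le_ofReal (by gcongr; exact le_max_left _ _))
  · exact (hC' Ω P W hW ε hε hε1).trans
      (ENNReal.ofReal_le_ofReal (by gcongr; exact le_max_left _ _))

/-- For `ε` bounded away from `0` nothing has to be proved: all paths may be discarded. -/
lemma isNegligible_large {ε₀ : ℝ} (hε₀ : 0 < ε₀) :
    IsNegligible.{u} (d := d) fun ε => {_w | ε₀ ≤ ε} := by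
  refine ⟨fun ε => MeasurableSet.const _, fun p hp => ⟨ε₀ ^ (-p), fun Ω _ P _ W _ ε hε _ => ?_⟩⟩
  by_cases h : ε₀ ≤ ε
  · refine prob_le_one.trans ?_
    rw [ENNReal.one_le_ofReal, Real.rpow_neg hε₀.le, inv_mul_eq_div,
      one_le_div (Real.rpow_pos_of_pos hε₀ p)]
    exact Real.rpow_le_rpow hε₀.le h hp.le
  · simp [h]

/-- The time in `ℝ≥0` at which `extendPath` evaluates a process at the real time `x`. -/
noncomputable def clampTime (x : ℝ) : ℝ≥0 := unitInterval.toNNReal (Set.projIcc 0 1 zero_le_one x)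

lemma extendPath_pathOn {Ω : Type*} (W : Fin d → ℝ≥0 → Ω → ℝ) (ω : Ω) (i : Fin d) (x : ℝ) :
    extendPath (pathOn W ω i) x = W i (clampTime x) ω := rfl

lemma coe_clampTime {x : ℝ} (h0 : 0 ≤ x) (h1 : x ≤ 1) : (clampTime x : ℝ) = x := by
  change ((Set.projIcc 0 1 zero_le_one x : unitInterval) : ℝ) = x
  rw [Set.projIcc_of_mem zero_le_one ⟨h0, h1⟩]

lemma clampTime_zero : clampTime 0 = 0 := by
  ext; rw [coe_clampTime le_rfl zero_le_one]; rfl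

lemma measure_dyadic_increment_le {Ω : Type*} [MeasurableSpace Ω] {P : Measure Ω}
    {B : ℝ≥0 → Ω → ℝ} (hB : IsPreBrownianReal B P) {C : ℝ} {Q : ℕ}
    (hC : ∀ (v : ℝ≥0) (x : ℝ), 0 < x →
      gaussianReal 0 v {y | x < |y|} ≤ ENNReal.ofReal (C * (√v / x) ^ Q))
    {n k : ℕ} (hk : k < 2 ^ n) {x : ℝ} (hx : 0 < x) :
    P {ω | x < |B (clampTime ((k + 1 : ℕ) / 2 ^ n)) ω - B (clampTime (k / 2 ^ n)) ω|}
      ≤ ENNReal.ofReal (C * (√((1 / 2) ^ n) / x) ^ Q) := by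
  have hp : (0 : ℝ) < 2 ^ n := by positivity
  have hk' : ((k + 1 : ℕ) : ℝ) ≤ 2 ^ n := by exact_mod_cast hk
  have hk'' : (k : ℝ) ≤ 2 ^ n := by exact_mod_cast hk.le
  have hlaw := hB.hasLaw_sub (clampTime ((k + 1 : ℕ) / 2 ^ n)) (clampTime (k / 2 ^ n))
  have hv : ((nndist (clampTime ((k + 1 : ℕ) / 2 ^ n)).1 (clampTime (k / 2 ^ n)).1 : ℝ≥0) : ℝ)
      = (1 / 2) ^ n := by
    rw [coe_nndist, Real.dist_eq, NNReal.val_eq_coe, NNReal.val_eq_coe,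
      coe_clampTime (by positivity) ((div_le_one hp).2 hk'),
      coe_clampTime (by positivity) ((div_le_one hp).2 hk''), ← sub_div, one_div, inv_pow,
      ← one_div]
    push_cast
    rw [add_sub_cancel_left, abs_of_pos (by positivity)]
  have := hlaw.measure_eq (p := fun y => x < |y|)
    (measurableSet_lt measurable_const (by fun_prop))
  refine this.trans_le ((hC _ x hx).trans_eq ?_)
  rw [hv]

/-- Wiener paths have Hölder exponent `γ` for every `γ < 1 / 2`, with a constant all of whose
moments are finite; here `ρ = 2 ^ (-γ)`. -/
lemma isNegligible_roughPaths {κ ρ : ℝ} (hκ : 0 < κ) (hρ : √(1 / 2) < ρ) :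
    IsNegligible.{u} fun ε => roughPaths d (ε ^ (-κ)) ρ := by
  have hs : 0 < √(1 / 2 : ℝ) := by positivity
  have hρ0 : 0 < ρ := hs.trans hρ
  refine ⟨fun ε => measurableSet_roughPaths _ _, fun p hp => ?_⟩
  -- `Q` is the order of the moment used: it has to beat both the exponent `p` and the number of
  -- dyadic intervals in each generation.
  obtain ⟨Q₁, hQ₁⟩ : ∃ Q : ℕ, (√(1 / 2) / ρ) ^ Q < 1 / 4 :=
    exists_pow_lt_of_lt_one (by norm_num) ((div_lt_one hρ0).2 hρ)
  obtain ⟨Q₂, hQ₂⟩ := exists_nat_ge (p / κ)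
  set Q := Q₁ + Q₂ with hQ
  have hσ : (√(1 / 2) / ρ) ^ Q ≤ 1 / 4 := by
    refine le_trans (pow_le_pow_of_le_one (by positivity) ((div_lt_one hρ0).2 hρ).le ?_) hQ₁.le
    omega
  have hpQ : p ≤ κ * Q := by
    rw [div_le_iff₀' hκ] at hQ₂
    refine hQ₂.trans ?_
    gcongr
    omega
  obtain ⟨C, hC0, hC⟩ := exists_gaussianReal_tail_le Q
  refine ⟨d * (2 * C), fun Ω _ P _ W hW ε hε hε1 => ?_⟩
  have hεp : 0 ≤ ε ^ p := Real.rpow_nonneg hε.le p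
  have hεκ : 0 < ε ^ (-κ) := Real.rpow_pos_of_pos hε _
  have hone : ∀ (i : Fin d) (n k : ℕ), k < 2 ^ n → P {ω | ε ^ (-κ) * ρ ^ n <
      |W i (clampTime ((k + 1 : ℕ) / 2 ^ n)) ω - W i (clampTime (k / 2 ^ n)) ω|}
        ≤ ENNReal.ofReal (C * ε ^ p * (1 / 4) ^ n) := by
    intro i n k hk
    refine (measure_dyadic_increment_le (hW.isBrownianReal i).toIsPreBrownianReal hC hk
      (by positivity)).trans (ENNReal.ofReal_le_ofReal ?_)
    rw [mul_assoc]
    gcongr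
    have e1 : √((1 / 2 : ℝ) ^ n) = √(1 / 2) ^ n := by
      rw [Real.sqrt_eq_iff_mul_self_eq (by positivity) (by positivity), ← mul_pow,
        Real.mul_self_sqrt (by norm_num)]
    have e2 : (√((1 / 2 : ℝ) ^ n) / (ε ^ (-κ) * ρ ^ n)) ^ Q
        = (ε ^ κ) ^ Q * ((√(1 / 2) / ρ) ^ Q) ^ n := by
      have hεκ' : 0 < ε ^ κ := Real.rpow_pos_of_pos hε _
      have e3 : √(1 / 2 : ℝ) ^ n / ((ε ^ κ)⁻¹ * ρ ^ n) = ε ^ κ * (√(1 / 2) / ρ) ^ n := by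
        rw [div_pow, mul_div_assoc', div_eq_div_iff (by positivity) (by positivity)]
        have : (ε ^ κ)⁻¹ * ε ^ κ = 1 := inv_mul_cancel₀ hεκ'.ne'
        linear_combination (-(√(1 / 2 : ℝ) ^ n * ρ ^ n)) * this
      rw [e1, Real.rpow_neg hε.le, e3, mul_pow, ← pow_mul, ← pow_mul, mul_comm Q n]
    rw [e2]
    gcongr
    rw [← Real.rpow_natCast, ← Real.rpow_mul hε.le]
    exact Real.rpow_le_rpow_of_exponent_ge hε hε1 hpQ
  have hsub : {ω | pathOn W ω ∈ roughPaths d (ε ^ (-κ)) ρ} ⊆ ⋃ i, ({ω | W i 0 ω ≠ 0} ∪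
      ⋃ n : ℕ, ⋃ k ∈ Finset.range (2 ^ n), {ω | ε ^ (-κ) * ρ ^ n <
        |W i (clampTime ((k + 1 : ℕ) / 2 ^ n)) ω - W i (clampTime (k / 2 ^ n)) ω|}) := by
    rintro ω ⟨i, h | ⟨n, k, hk, h⟩⟩
    · rw [extendPath_pathOn, clampTime_zero] at h
      exact Set.mem_iUnion.2 ⟨i, Or.inl h⟩
    · simp only [extendPath_pathOn] at h
      refine Set.mem_iUnion.2 ⟨i, Or.inr (Set.mem_iUnion.2 ⟨n, ?_⟩)⟩
      exact Set.mem_biUnion (Finset.mem_coe.2 (Finset.mem_range.2 hk)) h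
  refine (measure_mono hsub).trans ((measure_iUnion_fintype_le _ _).trans ?_)
  have hi : ∀ i : Fin d, P ({ω | W i 0 ω ≠ 0} ∪
      ⋃ n : ℕ, ⋃ k ∈ Finset.range (2 ^ n), {ω | ε ^ (-κ) * ρ ^ n <
        |W i (clampTime ((k + 1 : ℕ) / 2 ^ n)) ω - W i (clampTime (k / 2 ^ n)) ω|})
      ≤ ENNReal.ofReal (2 * C * ε ^ p) := by
    intro i
    have h0 : P {ω | W i 0 ω ≠ 0} = 0 := (hW.isBrownianReal i).eval_zero_ae_eq_zero
    refine (measure_union_le _ _).trans ?_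
    rw [h0, zero_add]
    refine (measure_iUnion_le _).trans ?_
    have hn : ∀ n : ℕ, P (⋃ k ∈ Finset.range (2 ^ n), {ω | ε ^ (-κ) * ρ ^ n <
        |W i (clampTime ((k + 1 : ℕ) / 2 ^ n)) ω - W i (clampTime (k / 2 ^ n)) ω|})
        ≤ ENNReal.ofReal (C * ε ^ p * (1 / 2) ^ n) := by
      intro n
      refine (measure_biUnion_finset_le _ _).trans ?_
      refine (Finset.sum_le_card_nsmul _ _ _ fun k hk => hone i n k (Finset.mem_range.1 hk)).trans ?_
      rw [Finset.card_range, nsmul_eq_mul, ← ENNReal.ofReal_natCast,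
        ← ENNReal.ofReal_mul (by positivity)]
      apply ENNReal.ofReal_le_ofReal
      have : (1 / 2 : ℝ) ^ n = 2 ^ n * (1 / 4) ^ n := by rw [← mul_pow]; norm_num
      rw [this]
      push_cast
      linarith
    refine (ENNReal.tsum_le_tsum hn).trans ?_
    rw [← ENNReal.ofReal_tsum_of_nonneg (fun n => by positivity)
      (summable_geometric_two.mul_left _), tsum_mul_left, tsum_geometric_two]
    apply ENNReal.ofReal_le_ofReal
    linarith
  refine (Finset.sum_le_card_nsmul _ _ _ fun i _ => hi i).trans ?_
  rw [nsmul_eq_mul, Finset.card_univ, Fintype.card_fin, ← ENNReal.ofReal_natCast,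
    ← ENNReal.ofReal_mul (by positivity)]
  apply ENNReal.ofReal_le_ofReal
  linarith

lemma exists_half_pow_le (Q : ℕ) : ∃ C : ℝ, 0 ≤ C ∧ ∀ n : ℕ, (n : ℝ) ^ Q * (1 / 2) ^ n ≤ C := by
  obtain ⟨C, hC⟩ := (tendsto_pow_const_mul_const_pow_of_abs_lt_one Q
    (r := (1 / 2 : ℝ)) (by rw [abs_of_pos] <;> norm_num)).bddAbove_range
  have h : ∀ n : ℕ, (n : ℝ) ^ Q * (1 / 2) ^ n ≤ C := fun n => hC ⟨n, rfl⟩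
  exact ⟨C, le_trans (by positivity) (h 0), h⟩

lemma card_latticeSphere_le (d M : ℕ) : (latticeSphere d M).card ≤ (2 * M + 1) ^ d := by
  refine (Finset.card_filter_le _ _).trans ?_
  rw [Fintype.card_piFinset_const, Int.card_Icc]
  apply le_of_eq
  congr 1
  omega

lemma measure_small_directionalIncrement_le {Ω : Type*} [MeasurableSpace Ω] {P : Measure Ω}
    [IsProbabilityMeasure P] {W : Fin d → ℝ≥0 → Ω → ℝ} (hW : IsWienerProcess W P) {b : Fin d → ℝ}
    {i₀ : Fin d} (hb : |b i₀| = 1) {q r k : ℕ} (hk : k < 2 ^ q) :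
    P {ω | ∀ j < 2 ^ r, |directionalIncrement q r b k j (pathOn W ω)|
        ≤ √((1 / 2) ^ (q + r)) / 2} ≤ (1 / 2) ^ (2 ^ r) := by
  set c := √(∑ i, b i ^ 2) with hc
  have hsum : 1 ≤ ∑ i, b i ^ 2 := by
    have : b i₀ ^ 2 = 1 := by rw [← sq_abs, hb]; norm_num
    rw [← this]
    exact Finset.single_le_sum (f := fun i => b i ^ 2) (fun i _ => sq_nonneg _)
      (Finset.mem_univ i₀)
  have hc1 : 1 ≤ c := Real.one_le_sqrt.2 hsum
  have hc0 : 0 < c := by linarith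
  have hunit : ∑ i, (b i / c) ^ 2 = 1 := by
    simp only [div_pow]
    rw [← Finset.sum_div, hc, Real.sq_sqrt (by linarith), div_self (by linarith)]
  set δ : ℝ≥0 := (1 / 2) ^ (q + r) with hδ
  have hδr : (δ : ℝ) = (1 / 2) ^ (q + r) := by rw [hδ]; push_cast; rfl
  set s : ℕ → ℝ≥0 := fun j => ((k * 2 ^ r + j : ℕ) : ℝ≥0) / 2 ^ (q + r) with hs
  have hstep : ∀ j, s (j + 1) = s j + δ := by
    intro j
    simp only [hs, hδ]
    rw [one_div, inv_pow, ← one_div, ← add_div]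
    congr 1
    push_cast; ring
  have hclamp : ∀ j ≤ 2 ^ r, clampTime (((k * 2 ^ r + j : ℕ) : ℝ) / 2 ^ (q + r)) = s j := by
    intro j hj
    ext
    rw [coe_clampTime (by positivity)]
    · simp [hs]
    · rw [div_le_one (by positivity), pow_add]
      have : k * 2 ^ r + j ≤ 2 ^ q * 2 ^ r := by
        calc k * 2 ^ r + j ≤ (k + 1) * 2 ^ r := by rw [add_mul, one_mul]; omega
          _ ≤ 2 ^ q * 2 ^ r := Nat.mul_le_mul_right _ hk
      exact_mod_cast this
  refine (measure_mono fun ω hω j hj => ?_).trans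
    (measure_small_increments_le (hW.isPreBrownianReal_sum hunit) (δ := δ) (by positivity)
      hstep (2 ^ r))
  have h := hω j hj
  have e : directionalIncrement q r b k j (pathOn W ω)
      = c * (∑ i, b i / c * W i (s (j + 1)) ω - ∑ i, b i / c * W i (s j) ω) := by
    rw [← Finset.sum_sub_distrib, Finset.mul_sum, directionalIncrement]
    refine Finset.sum_congr rfl fun i _ => ?_
    rw [extendPath_pathOn, extendPath_pathOn, hclamp _ hj, hclamp _ hj.le]
    field_simp
  rw [e, abs_mul, abs_of_pos hc0, ← hδr] at h
  exact (le_mul_of_one_le_left (abs_nonneg _) hc1).trans h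

/-- Degeneracy is superpolynomially unlikely: there are polynomially many blocks and directions,
and each of them fails with probability at most `2 ^ (-2 ^ r)`. -/
lemma isNegligible_degeneratePaths {a κ : ℝ} (hκ : 0 < κ) {q r M : ℝ → ℕ}
    (hq : ∀ ε : ℝ, 0 < ε → ε ≤ 1 → (2 : ℝ) ^ q ε ≤ 2 * ε ^ (-a))
    (hr : ∀ ε : ℝ, 0 < ε → ε ≤ 1 → ε ^ (-κ) ≤ 2 ^ r ε)
    (hM : ∀ ε : ℝ, 0 < ε → ε ≤ 1 → (M ε : ℝ) ≤ 2 * ε⁻¹)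
    (hM0 : ∀ ε : ℝ, 0 < ε → ε ≤ 1 → 0 < M ε) :
    IsNegligible.{u} fun ε => degeneratePaths d (q ε) (r ε) (M ε) := by
  refine ⟨fun ε => measurableSet_degeneratePaths _ _ _, fun p hp => ?_⟩
  obtain ⟨Q, hQ⟩ := exists_nat_ge ((p + a + d) / κ)
  rw [div_le_iff₀' hκ] at hQ
  obtain ⟨C, hC0, hC⟩ := exists_half_pow_le Q
  refine ⟨2 * 5 ^ d * C, fun Ω _ P _ W hW ε hε hε1 => ?_⟩
  have hsub : {ω | pathOn W ω ∈ degeneratePaths d (q ε) (r ε) (M ε)} ⊆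
      ⋃ k ∈ Finset.range (2 ^ q ε), ⋃ l ∈ latticeSphere d (M ε), {ω | ∀ j < 2 ^ r ε,
        |directionalIncrement (q ε) (r ε) (fun i => (l i : ℝ) / M ε) k j (pathOn W ω)|
          ≤ √((1 / 2) ^ (q ε + r ε)) / 2} := by
    rintro ω ⟨k, hk, l, hl, h⟩
    simp only [Set.mem_iUnion]
    exact ⟨k, Finset.mem_range.2 hk, l, hl, h⟩
  have hM0' : (0 : ℝ) < M ε := by exact_mod_cast hM0 ε hε hε1
  have hdir : ∀ k ∈ Finset.range (2 ^ q ε), P (⋃ l ∈ latticeSphere d (M ε), {ω | ∀ j < 2 ^ r ε,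
        |directionalIncrement (q ε) (r ε) (fun i => (l i : ℝ) / M ε) k j (pathOn W ω)|
          ≤ √((1 / 2) ^ (q ε + r ε)) / 2})
      ≤ (latticeSphere d (M ε)).card • (1 / 2 : ℝ≥0∞) ^ (2 ^ r ε) := by
    intro k hk
    refine (measure_biUnion_finset_le _ _).trans (Finset.sum_le_card_nsmul _ _ _ fun l hl => ?_)
    obtain ⟨i₀, hi₀⟩ := (Finset.mem_filter.1 hl).2
    refine measure_small_directionalIncrement_le hW (i₀ := i₀) ?_ (Finset.mem_range.1 hk)
    have : |(l i₀ : ℝ)| = M ε := by exact_mod_cast congrArg (Int.cast : ℤ → ℝ) hi₀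
    rw [abs_div, this, Nat.abs_cast, div_self hM0'.ne']
  refine (measure_mono hsub).trans ((measure_biUnion_finset_le _ _).trans
    ((Finset.sum_le_card_nsmul _ _ _ hdir).trans ?_))
  have hcast : (2 ^ q ε) • ((latticeSphere d (M ε)).card • (1 / 2 : ℝ≥0∞) ^ (2 ^ r ε))
      = ENNReal.ofReal (2 ^ q ε * ((latticeSphere d (M ε)).card * (1 / 2) ^ (2 ^ r ε))) := by
    rw [nsmul_eq_mul, nsmul_eq_mul, ENNReal.ofReal_mul (by positivity),
      ENNReal.ofReal_mul (by positivity), ENNReal.ofReal_pow (by norm_num),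
      ENNReal.ofReal_pow (by norm_num), ENNReal.ofReal_natCast,
      ENNReal.ofReal_div_of_pos (by norm_num)]
    simp
  rw [Finset.card_range, hcast]
  apply ENNReal.ofReal_le_ofReal
  have hcard : ((latticeSphere d (M ε)).card : ℝ) ≤ (5 * ε⁻¹) ^ d := by
    have h1 : ((latticeSphere d (M ε)).card : ℝ) ≤ (2 * M ε + 1) ^ d := by
      exact_mod_cast card_latticeSphere_le d (M ε)
    refine h1.trans ?_
    gcongr
    have := hM ε hε hε1
    have := (one_le_inv₀ hε).2 hε1
    linarith
  have hhalf : (1 / 2 : ℝ) ^ (2 ^ r ε) ≤ C * ε ^ (κ * Q) := by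
    have h1 := hC (2 ^ r ε)
    have h2 : ε ^ (-(κ * Q)) ≤ ((2 ^ r ε : ℕ) : ℝ) ^ Q := by
      have h3 := pow_le_pow_left₀ (Real.rpow_nonneg hε.le _) (hr ε hε hε1) Q
      rw [← Real.rpow_natCast (ε ^ (-κ)), ← Real.rpow_mul hε.le, neg_mul] at h3
      exact_mod_cast h3
    have h4 : ε ^ (-(κ * Q)) * (1 / 2 : ℝ) ^ (2 ^ r ε) ≤ C :=
      (mul_le_mul_of_nonneg_right h2 (by positivity)).trans h1
    rwa [Real.rpow_neg hε.le, inv_mul_le_iff₀ (Real.rpow_pos_of_pos hε _), mul_comm] at h4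
  calc (2 : ℝ) ^ q ε * ((latticeSphere d (M ε)).card * (1 / 2) ^ (2 ^ r ε))
      ≤ (2 * ε ^ (-a)) * ((5 * ε⁻¹) ^ d * (C * ε ^ (κ * Q))) := by
        have := Real.rpow_nonneg hε.le (-a)
        have := hq ε hε hε1
        gcongr
    _ = 2 * 5 ^ d * C * ε ^ (κ * Q + -a + -(d : ℝ)) := by
        rw [Real.rpow_add hε, Real.rpow_add hε, mul_pow, Real.rpow_neg hε.le (d : ℝ),
          Real.rpow_natCast, inv_pow]
        ring
    _ ≤ 2 * 5 ^ d * C * ε ^ p := by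
        gcongr 2 * 5 ^ d * C * ?_
        exact Real.rpow_le_rpow_of_exponent_ge hε hε1 (by linarith)

end Negligible

/-! ### Gain of smallness for derivatives off a negligible family -/

lemma exists_forall_le_rpow_neg (D : ℝ) {κ : ℝ} (hκ : 0 < κ) :
    ∃ ε₀ : ℝ, 0 < ε₀ ∧ ∀ ε : ℝ, 0 < ε → ε < ε₀ → D ≤ ε ^ (-κ) := by
  have hD : 0 < max D 1 := lt_max_of_lt_right one_pos
  refine ⟨max D 1 ^ (-κ⁻¹), Real.rpow_pos_of_pos hD _, fun ε hε h => ?_⟩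
  have h1 := Real.rpow_le_rpow_of_nonpos hε h.le (neg_nonpos.2 hκ.le)
  rw [← Real.rpow_mul hD.le, neg_mul_neg, inv_mul_cancel₀ hκ.ne', Real.rpow_one] at h1
  exact (le_max_left _ _).trans h1

lemma exists_two_pow_near {y : ℝ} (hy : 1 ≤ y) : ∃ n : ℕ, y ≤ 2 ^ n ∧ (2 : ℝ) ^ n ≤ 2 * y := by
  obtain ⟨n, h1, h2⟩ := exists_nat_pow_near hy one_lt_two
  exact ⟨n + 1, h2.le, by rw [pow_succ]; linarith⟩

lemma one_le_rpow_neg {ε a : ℝ} (hε : 0 < ε) (hε1 : ε ≤ 1) (ha : 0 ≤ a) : 1 ≤ ε ^ (-a) :=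
  Real.one_le_rpow_of_pos_of_le_one_of_nonpos hε hε1 (neg_nonpos.2 ha)

/-- A choice of integers `n ε` with `2 ^ n ε` comparable to `ε ^ (-a)`. -/
lemma exists_two_pow_rpow_near {a : ℝ} (ha : 0 ≤ a) : ∃ n : ℝ → ℕ, ∀ ε : ℝ, 0 < ε → ε ≤ 1 →
    ε ^ (-a) ≤ 2 ^ n ε ∧ (2 : ℝ) ^ n ε ≤ 2 * ε ^ (-a) := by
  have h : ∀ ε : ℝ, ∃ n : ℕ, 0 < ε → ε ≤ 1 → ε ^ (-a) ≤ 2 ^ n ∧ (2 : ℝ) ^ n ≤ 2 * ε ^ (-a) := by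
    intro ε
    by_cases hε : 0 < ε ∧ ε ≤ 1
    · obtain ⟨n, hn⟩ := exists_two_pow_near (one_le_rpow_neg hε.1 hε.2 ha)
      exact ⟨n, fun _ _ => hn⟩
    · exact ⟨0, fun h1 h2 => absurd ⟨h1, h2⟩ hε⟩
  choose n hn using h
  exact ⟨n, hn⟩

section Main
universe u

/-- Wiener paths are bounded by `ε ^ (-κ)` off a negligible family. -/
lemma exists_isNegligible_abs_le (d : ℕ) {κ : ℝ} (hκ : 0 < κ) :
    ∃ N : ℝ → Set (Fin d → unitInterval → ℝ), IsNegligible.{u} N ∧ ∀ ε : ℝ, 0 < ε → ε ≤ 1 →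
      ∀ w : Fin d → unitInterval → ℝ, (∀ i, Continuous (w i)) → w ∉ N ε →
        ∀ i t, |w i t| ≤ ε ^ (-κ) := by
  obtain ⟨ε₀, hε₀, hsmall⟩ := exists_forall_le_rpow_neg 12 (half_pos hκ)
  have hρ : √(1 / 2 : ℝ) < 3 / 4 := by
    rw [Real.sqrt_lt' (by norm_num)]; norm_num
  refine ⟨_, (isNegligible_large hε₀).union (isNegligible_roughPaths (half_pos hκ) hρ),
    fun ε hε hε1 w hw hN i t => ?_⟩
  rw [Set.mem_union, not_or] at hN
  have hlt : ε < ε₀ := not_le.1 hN.1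
  have hpos := Real.rpow_pos_of_pos hε (-(κ / 2))
  have h := abs_le_of_notMem_roughPaths hpos.le (by norm_num) (by norm_num) hw hN.2 i t
  calc |w i t| ≤ 3 / (1 - 3 / 4) * ε ^ (-(κ / 2)) := h
    _ = 12 * ε ^ (-(κ / 2)) := by norm_num
    _ ≤ ε ^ (-(κ / 2)) * ε ^ (-(κ / 2)) := by gcongr; exact hsmall ε hε hlt
    _ = ε ^ (-κ) := by rw [← Real.rpow_add hε]; congr 1; ring

/-- The bound of `abs_wienerPolynomial_derivCoeff_le` at the scales `h = 2 ^ (-q)` and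
`2 ^ (-(q + r))`, with all powers of `ε` of small exponent collected in `x`. -/
lemma le_of_derivative_scale_bound {m q r : ℕ} {X E L σ x C n : ℝ} (hE : 0 < E) (hσ : 0 < σ)
    (hx : 1 ≤ x) (hC : 1 ≤ C) (hn : 0 ≤ n)
    (hLh : L * (1 / 2) ^ q ≤ E) (hδ : (2 : ℝ) ^ (q + r) ≤ (2 * σ * x) ^ 2)
    (hX : |X| * √((1 / 2) ^ (q + r)) ≤ 8 * (2 * E + n * (L * (C * x) ^ (m + 1) *
      ((1 / 2) ^ q + (m + 1) ^ 2 * (4 * C * x ^ 2 * √((1 / 2) ^ q)) ^ 2)))) :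
    |X| ≤ 16 * (2 + n * (C ^ (m + 1) * (1 + 16 * (m + 1) ^ 2 * C ^ 2))) *
      (E * σ * x ^ (m + 6)) := by
  have hx0 : 0 < x := by linarith
  have hC0 : 0 < C := by linarith
  have hh : (0 : ℝ) ≤ (1 / 2) ^ q := by positivity
  have hs : √((1 / 2 : ℝ) ^ (q + r)) * √(2 ^ (q + r)) = 1 := by
    rw [← Real.sqrt_mul (by positivity), ← mul_pow]; norm_num
  have hs2 : √((2 : ℝ) ^ (q + r)) ≤ 2 * σ * x := Real.sqrt_le_iff.2 ⟨by positivity, hδ⟩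
  have hx4 : (1 : ℝ) ≤ x ^ 4 := one_le_pow₀ hx
  have hx5 : (1 : ℝ) ≤ x ^ (m + 5) := one_le_pow₀ hx
  have hb : L * (C * x) ^ (m + 1) *
      ((1 / 2) ^ q + (m + 1) ^ 2 * (4 * C * x ^ 2 * √((1 / 2) ^ q)) ^ 2)
      ≤ (C ^ (m + 1) * (1 + 16 * (m + 1) ^ 2 * C ^ 2)) * (E * x ^ (m + 5)) := by
    have e : L * (C * x) ^ (m + 1) *
        ((1 / 2) ^ q + (m + 1) ^ 2 * (4 * C * x ^ 2 * √((1 / 2) ^ q)) ^ 2)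
        = (L * (1 / 2) ^ q) * (C ^ (m + 1) * x ^ (m + 1)
          * (1 + 16 * (m + 1) ^ 2 * C ^ 2 * x ^ 4)) := by
      rw [mul_pow _ (√((1 / 2 : ℝ) ^ q)), Real.sq_sqrt hh]; ring
    rw [e]
    calc _ ≤ E * (C ^ (m + 1) * x ^ (m + 1)
          * (x ^ 4 + 16 * (m + 1) ^ 2 * C ^ 2 * x ^ 4)) := by gcongr
      _ = _ := by ring
  calc |X| = |X| * √((1 / 2) ^ (q + r)) * √(2 ^ (q + r)) := by rw [mul_assoc, hs, mul_one]
    _ ≤ (8 * (2 * (E * x ^ (m + 5))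
          + n * ((C ^ (m + 1) * (1 + 16 * (m + 1) ^ 2 * C ^ 2)) * (E * x ^ (m + 5)))))
          * (2 * σ * x) := by
        refine mul_le_mul (hX.trans ?_) hs2 (Real.sqrt_nonneg _) (by positivity)
        have : E ≤ E * x ^ (m + 5) := le_mul_of_one_le_right hE.le hx5
        gcongr
    _ = _ := by ring

/-- If `Z` is at most `ε ^ e` and the coefficients and their Lipschitz constants are at most
`ε ^ (-lam)`, then off a negligible family the derivatives of `Z` are at most
`ε ^ ((e - lam) / 2 - κ)`. The time scale `ε ^ (e + lam)` is the one at which the variation of the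
coefficients is comparable with the bound on `Z`. -/
lemma exists_isNegligible_derivCoeff_le (d m : ℕ) {e lam κ : ℝ} (hσ : 0 < e + lam) (hκ : 0 < κ) :
    ∃ N : ℝ → Set (Fin d → unitInterval → ℝ), IsNegligible.{u} N ∧ ∀ ε : ℝ, 0 < ε → ε ≤ 1 →
      ∀ w : Fin d → unitInterval → ℝ, (∀ i, Continuous (w i)) → w ∉ N ε →
        ∀ A : MultiIndex d (m + 1) → unitInterval → ℝ, (∀ α t, |A α t| ≤ ε ^ (-lam)) →
          (∀ α (s t : unitInterval), |A α s - A α t| ≤ ε ^ (-lam) * |(s : ℝ) - t|) →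
          (∀ t, |wienerPolynomial w A t| ≤ ε ^ e) →
            ∀ i t, |wienerPolynomial w (derivCoeff A i) t| ≤ ε ^ ((e - lam) / 2 - κ) := by
  obtain ⟨κ₁, hκ₁, hκ₁4, hκ₁κ⟩ : ∃ κ₁ : ℝ, 0 < κ₁ ∧ κ₁ ≤ 1 / 4 ∧ (m + 7) * κ₁ ≤ κ := by
    refine ⟨min (1 / 4) (κ / (m + 7)), by positivity, min_le_left _ _, ?_⟩
    have := min_le_right (1 / 4) (κ / (m + 7 : ℝ))
    rwa [le_div_iff₀' (by positivity)] at this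
  -- The Hölder exponent is `1 / 2 - θ`, with `θ` so small that the loss over the finest scale
  -- `ε ^ (e + lam + κ₁)` is at most `ε ^ (-κ₁)`.
  obtain ⟨θ, hθ, hθ4, hθκ⟩ : ∃ θ : ℝ, 0 < θ ∧ θ ≤ 1 / 4 ∧ (e + lam + κ₁) * θ ≤ κ₁ := by
    refine ⟨min (1 / 4) (κ₁ / (e + lam + κ₁)), by positivity, min_le_left _ _, ?_⟩
    have := min_le_right (1 / 4) (κ₁ / (e + lam + κ₁))
    rwa [le_div_iff₀' (by positivity)] at this
  set ρ : ℝ := 2 ^ θ * √(1 / 2) with hρdef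
  have hs0 : 0 < √(1 / 2 : ℝ) := by positivity
  have hρ : √(1 / 2) < ρ := lt_mul_of_one_lt_left hs0 (Real.one_lt_rpow one_lt_two hθ)
  have hρ0 : 0 < ρ := hs0.trans hρ
  have hρ1 : ρ < 1 := by
    have h1 : √(1 / 2 : ℝ) = 2 ^ (-(1 / 2) : ℝ) := by
      rw [Real.sqrt_eq_rpow, one_div, Real.inv_rpow (by norm_num), Real.rpow_neg (by norm_num)]
    rw [hρdef, h1, ← Real.rpow_add two_pos]
    exact Real.rpow_lt_one_of_one_lt_of_neg one_lt_two (by linarith)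
  have hρn : ∀ n : ℕ, ρ ^ n = ((2 : ℝ) ^ n) ^ θ * √((1 / 2) ^ n) := by
    intro n
    have e1 : √((1 / 2 : ℝ) ^ n) = √(1 / 2) ^ n := by
      rw [Real.sqrt_eq_iff_mul_self_eq (by positivity) (by positivity), ← mul_pow,
        Real.mul_self_sqrt (by norm_num)]
    rw [hρdef, mul_pow, e1, ← Real.rpow_natCast ((2 : ℝ) ^ θ), ← Real.rpow_mul two_pos.le,
      mul_comm θ, Real.rpow_mul two_pos.le, Real.rpow_natCast]
  set C := 3 / (1 - ρ) with hCdef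
  have hC1 : 1 ≤ C := by rw [hCdef, one_le_div (by linarith)]; linarith
  have hC0 : 0 < C := by linarith
  set n : ℝ := ((Fintype.card (MultiIndex d (m + 1)) : ℕ) : ℝ) with hn
  obtain ⟨ε₁, hε₁, hsmall₁⟩ := exists_forall_le_rpow_neg
    (16 * (2 + n * (C ^ (m + 1) * (1 + 16 * (m + 1) ^ 2 * C ^ 2)))) hκ₁
  obtain ⟨ε₂, hε₂, hsmall₂⟩ := exists_forall_le_rpow_neg (16 * d * C) (one_half_pos (α := ℝ))
  obtain ⟨q, hq⟩ := exists_two_pow_rpow_near hσ.le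
  obtain ⟨r, hr⟩ := exists_two_pow_rpow_near hκ₁.le
  have hM1 : ∀ ε : ℝ, 0 < ε → ε ≤ 1 → ((⌈ε⁻¹⌉₊ : ℕ) : ℝ) ≤ 2 * ε⁻¹ := fun ε hε hε1 => by
    have h1 := (Nat.ceil_lt_add_one (inv_nonneg.2 hε.le)).le
    have h2 := (one_le_inv₀ hε).2 hε1
    linarith
  have hM0 : ∀ ε : ℝ, 0 < ε → ε ≤ 1 → 0 < ⌈ε⁻¹⌉₊ := fun ε hε _ => Nat.ceil_pos.2 (inv_pos.2 hε)
  refine ⟨_, ((isNegligible_large (lt_min hε₁ hε₂)).union (isNegligible_roughPaths hκ₁ hρ)).union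
    (isNegligible_degeneratePaths hκ₁ (fun ε h h' => (hq ε h h').2) (fun ε h h' => (hr ε h h').1)
      hM1 hM0), fun ε hε hε1 w hw hN A hA hA' hZ i t => ?_⟩
  rw [Set.mem_union, Set.mem_union, not_or, not_or] at hN
  obtain ⟨⟨hlt, hrough⟩, hdeg⟩ := hN
  replace hlt : ε < min ε₁ ε₂ := not_le.1 hlt
  set x := ε ^ (-κ₁) with hxdef
  have hx1 : 1 ≤ x := one_le_rpow_neg hε hε1 hκ₁.le
  have hx0 : 0 < x := by linarith
  have hqr : (2 : ℝ) ^ (q ε + r ε) ≤ 4 * ε ^ (-(e + lam + κ₁)) := by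
    rw [pow_add, neg_add, Real.rpow_add hε]
    calc (2 : ℝ) ^ q ε * 2 ^ r ε ≤ (2 * ε ^ (-(e + lam))) * (2 * ε ^ (-κ₁)) :=
          mul_le_mul (hq ε hε hε1).2 (hr ε hε hε1).2 (by positivity)
            (mul_nonneg two_pos.le (Real.rpow_nonneg hε.le _))
      _ = _ := by ring
  have hloss : ∀ k ≤ q ε + r ε, ((2 : ℝ) ^ k) ^ θ ≤ 4 * x := by
    intro k hk
    have h4 : (4 : ℝ) ^ θ ≤ 4 := by
      conv_rhs => rw [← Real.rpow_one 4]
      exact Real.rpow_le_rpow_of_exponent_le (by norm_num) (by linarith)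
    calc ((2 : ℝ) ^ k) ^ θ ≤ (4 * ε ^ (-(e + lam + κ₁))) ^ θ := by
          refine Real.rpow_le_rpow (by positivity) (le_trans ?_ hqr) hθ.le
          exact pow_le_pow_right₀ one_le_two hk
      _ = 4 ^ θ * ε ^ (-((e + lam + κ₁) * θ)) := by
          rw [Real.mul_rpow (by norm_num) (Real.rpow_nonneg hε.le _), ← Real.rpow_mul hε.le,
            neg_mul]
      _ ≤ 4 * x := by
          refine mul_le_mul h4 ?_ (Real.rpow_nonneg hε.le _) (by norm_num)
          exact Real.rpow_le_rpow_of_exponent_ge hε hε1 (by linarith)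
  have hmod : ∀ k ≤ q ε + r ε, ∀ i (s t : unitInterval), |(s : ℝ) - t| ≤ (1 / 2) ^ k →
      |w i s - w i t| ≤ 4 * C * x ^ 2 * √((1 / 2) ^ k) := by
    intro k hk i s t hst
    refine (abs_sub_le_of_notMem_roughPaths hx0.le hρ0.le hρ1 hw hrough i s t k hst).trans ?_
    rw [hρn]
    calc C * (x * (((2 : ℝ) ^ k) ^ θ * √((1 / 2) ^ k)))
        ≤ C * (x * (4 * x * √((1 / 2) ^ k))) := by gcongr; exact hloss k hk
      _ = _ := by ring
  have hωM : 4 * d * (4 * C * x ^ 2 * √((1 / 2) ^ (q ε + r ε))) / (⌈ε⁻¹⌉₊ : ℕ)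
      ≤ √((1 / 2) ^ (q ε + r ε)) := by
    have hMpos : (0 : ℝ) < (⌈ε⁻¹⌉₊ : ℕ) := by exact_mod_cast hM0 ε hε hε1
    rw [div_le_iff₀ hMpos]
    have h1 : 16 * d * C * x ^ 2 ≤ (⌈ε⁻¹⌉₊ : ℕ) := by
      refine le_trans ?_ (Nat.le_ceil _)
      have h2 : x ^ 2 ≤ ε ^ (-(1 / 2) : ℝ) := by
        rw [hxdef, ← Real.rpow_natCast, ← Real.rpow_mul hε.le]
        refine Real.rpow_le_rpow_of_exponent_ge hε hε1 ?_
        push_cast; linarith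
      calc 16 * d * C * x ^ 2 ≤ ε ^ (-(1 / 2) : ℝ) * ε ^ (-(1 / 2) : ℝ) := by
            have := hsmall₂ ε hε (hlt.trans_le (min_le_right _ _))
            have := Real.rpow_nonneg hε.le (-(1 / 2))
            gcongr
        _ = ε⁻¹ := by
            rw [← Real.rpow_add hε, ← Real.rpow_neg_one]; norm_num
    calc 4 * d * (4 * C * x ^ 2 * √((1 / 2) ^ (q ε + r ε)))
        = √((1 / 2) ^ (q ε + r ε)) * (16 * d * C * x ^ 2) := by ring
      _ ≤ _ := by gcongr
  have hX := abs_wienerPolynomial_derivCoeff_le (K := C * x)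
    (ω := 4 * C * x ^ 2 * √((1 / 2) ^ q ε)) hdeg (hM0 ε hε hε1)
    (one_le_mul_of_one_le_of_one_le hC1 hx1) (Real.rpow_nonneg hε.le _)
    (fun i t => abs_le_of_notMem_roughPaths hx0.le hρ0.le hρ1 hw hrough i t) (by positivity)
    (hmod _ (Nat.le_add_right _ _)) (hmod _ le_rfl) hωM hA hA' hZ i t
  have hLh : ε ^ (-lam) * (1 / 2) ^ q ε ≤ ε ^ e := by
    have h1 := (hq ε hε hε1).1
    have h2 : (1 / 2 : ℝ) ^ q ε ≤ ε ^ (e + lam) := by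
      rw [one_div, inv_pow, inv_le_comm₀ (by positivity) (Real.rpow_pos_of_pos hε _),
        ← Real.rpow_neg hε.le]
      exact h1
    calc ε ^ (-lam) * (1 / 2) ^ q ε ≤ ε ^ (-lam) * ε ^ (e + lam) := by gcongr
      _ = ε ^ e := by rw [← Real.rpow_add hε]; congr 1; ring
  have hδ : (2 : ℝ) ^ (q ε + r ε) ≤ (2 * ε ^ (-((e + lam) / 2)) * x) ^ 2 := by
    have h1 : (ε ^ (-((e + lam) / 2))) ^ 2 = ε ^ (-(e + lam)) := by
      rw [← Real.rpow_natCast, ← Real.rpow_mul hε.le]; congr 1; push_cast; ring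
    calc _ ≤ 4 * ε ^ (-(e + lam + κ₁)) := hqr
      _ = 4 * ε ^ (-(e + lam)) * x := by rw [neg_add, Real.rpow_add hε]; ring
      _ ≤ 4 * ε ^ (-(e + lam)) * x ^ 2 := by
          gcongr
          exact le_self_pow₀ hx1 two_ne_zero
      _ = _ := by rw [mul_pow, mul_pow, h1]; norm_num
  have hfin := le_of_derivative_scale_bound (Real.rpow_pos_of_pos hε e)
    (Real.rpow_pos_of_pos hε (-((e + lam) / 2))) hx1 hC1 (Nat.cast_nonneg _)
    hLh hδ hX
  refine hfin.trans ?_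
  calc _ ≤ x * (ε ^ e * ε ^ (-((e + lam) / 2)) * x ^ (m + 6)) := by
        have := hsmall₁ ε hε (hlt.trans_le (min_le_left _ _))
        gcongr
    _ = ε ^ ((e - lam) / 2) * x ^ (m + 7) := by
        rw [← Real.rpow_add hε, show e + -((e + lam) / 2) = (e - lam) / 2 by ring]; ring
    _ = ε ^ ((e - lam) / 2 - (m + 7) * κ₁) := by
        rw [hxdef, ← Real.rpow_natCast, ← Real.rpow_mul hε.le, ← Real.rpow_add hε]
        congr 1; push_cast; ring
    _ ≤ _ := Real.rpow_le_rpow_of_exponent_ge hε hε1 (by linarith)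

end Main

/-! ### Induction on the degree -/

section Induction
universe u

lemma wienerPolynomial_degree_zero {d : ℕ} (w : Fin d → unitInterval → ℝ)
    (A : MultiIndex d 0 → unitInterval → ℝ) (α : MultiIndex d 0) (t : unitInterval) :
    wienerPolynomial w A t = A α t := by
  have h0 : ∀ β : MultiIndex d 0, β.1 = 0 := fun β =>
    Multiset.card_eq_zero.1 (Nat.le_zero.1 β.2)
  rw [wienerPolynomial, Fintype.sum_eq_single α fun β hβ =>
    absurd (Subtype.ext ((h0 β).trans (h0 α).symm)) hβ]
  simp [pathMonomial, h0 α]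

/-- Once all coefficients of positive degree are small, so is the constant one. -/
lemma abs_coeff_empty_le {d m : ℕ} {w : Fin d → unitInterval → ℝ}
    {A : MultiIndex d m → unitInterval → ℝ} {η K b : ℝ} (hK : 1 ≤ K) (hw : ∀ i t, |w i t| ≤ K)
    (t : unitInterval) (hZ : |wienerPolynomial w A t| ≤ η)
    (hA : ∀ α : MultiIndex d m, α.1 ≠ 0 → |A α t| ≤ b) (hb : 0 ≤ b) {α : MultiIndex d m}
    (hα : α.1 = 0) : |A α t| ≤ η + Fintype.card (MultiIndex d m) * (b * K ^ m) := by
  classical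
  have hsplit := Finset.add_sum_erase Finset.univ (fun β => A β t * pathMonomial w β.1 t)
    (Finset.mem_univ α)
  have h1 : pathMonomial w α.1 t = 1 := by simp [pathMonomial, hα]
  rw [h1, mul_one] at hsplit
  have e : A α t = wienerPolynomial w A t
      - ∑ β ∈ Finset.univ.erase α, A β t * pathMonomial w β.1 t := by
    rw [wienerPolynomial, ← hsplit]; ring
  rw [e]
  refine (abs_sub _ _).trans (add_le_add hZ ?_)
  refine (Finset.abs_sum_le_sum_abs _ _).trans
    ((Finset.sum_le_card_nsmul _ _ (b * K ^ m) fun β hβ => ?_).trans ?_)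
  · rw [abs_mul]
    have hβ0 : β.1 ≠ 0 := fun h => Finset.ne_of_mem_erase hβ (Subtype.ext (h.trans hα.symm))
    exact mul_le_mul (hA β hβ0) (abs_monomial_le hK (fun i => hw i t) β.1 β.2) (abs_nonneg _) hb
  · rw [nsmul_eq_mul]
    have : 0 ≤ b * K ^ m := by positivity
    gcongr
    exact Finset.card_le_univ _

/-- Off a negligible family, a Wiener polynomial of size `ε ^ e` whose coefficients and their
Lipschitz constants are at most `ε ^ (-lam)` has coefficients of size `ε ^ μ`, for every
`μ < (e + lam) / 2 ^ m - lam`. Passing to derivatives replaces `e + lam` by `(e + lam) / 2`. -/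
theorem exists_isNegligible_coeff_le (d m : ℕ) : ∀ e lam μ : ℝ, 0 < e + lam →
    μ < (e + lam) / 2 ^ m - lam →
    ∃ N : ℝ → Set (Fin d → unitInterval → ℝ), IsNegligible.{u} N ∧ ∀ ε : ℝ, 0 < ε → ε ≤ 1 →
      ∀ w : Fin d → unitInterval → ℝ, (∀ i, Continuous (w i)) → w ∉ N ε →
        ∀ A : MultiIndex d m → unitInterval → ℝ, (∀ α t, |A α t| ≤ ε ^ (-lam)) →
          (∀ α (s t : unitInterval), |A α s - A α t| ≤ ε ^ (-lam) * |(s : ℝ) - t|) →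
          (∀ t, |wienerPolynomial w A t| ≤ ε ^ e) → ∀ α t, |A α t| ≤ ε ^ μ := by
  induction m with
  | zero =>
    intro e lam μ _ hμ
    refine ⟨_, isNegligible_large one_pos, fun ε hε hε1 w _ _ A _ _ hZ α t => ?_⟩
    rw [← wienerPolynomial_degree_zero w A α t]
    refine (hZ t).trans (Real.rpow_le_rpow_of_exponent_ge hε hε1 ?_)
    rw [pow_zero, div_one] at hμ
    linarith
  | succ m ih =>
    intro e lam μ hσ hμ
    obtain ⟨κ, hκ, hgap⟩ : ∃ κ : ℝ, 0 < κ ∧ μ + 4 * κ = (e + lam) / 2 ^ (m + 1) - lam :=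
      ⟨((e + lam) / 2 ^ (m + 1) - lam - μ) / 4, by linarith, by ring⟩
    have hμe : μ + κ / 2 ≤ e := by
      have : (e + lam) / 2 ^ (m + 1) ≤ e + lam :=
        div_le_self hσ.le (one_le_pow₀ one_le_two)
      linarith
    have hm : (0 : ℝ) < m + 1 := by positivity
    obtain ⟨N₁, hN₁, hder⟩ := exists_isNegligible_derivCoeff_le.{u} d m hσ hκ
    obtain ⟨N₂, hN₂, hcoeff⟩ := ih ((e - lam) / 2 - κ) (lam + κ) (μ + κ) (by linarith) (by
      have : (e - lam) / 2 - κ + (lam + κ) = (e + lam) / 2 := by ring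
      rw [this, div_div, ← pow_succ']
      linarith)
    obtain ⟨N₃, hN₃, hsup⟩ := exists_isNegligible_abs_le.{u} d (κ := κ / 2 / (m + 1)) (by positivity)
    obtain ⟨ε₁, hε₁, hsmall₁⟩ := exists_forall_le_rpow_neg (m + 1) hκ
    obtain ⟨ε₂, hε₂, hsmall₂⟩ := exists_forall_le_rpow_neg
      (1 + (Fintype.card (MultiIndex d (m + 1)) : ℕ)) (half_pos hκ)
    refine ⟨_, (hN₁.union hN₂).union (hN₃.union (isNegligible_large (lt_min hε₁ hε₂))),
      fun ε hε hε1 w hw hN A hA hA' hZ => ?_⟩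
    simp only [Set.mem_union, not_or] at hN
    obtain ⟨⟨hw₁, hw₂⟩, hw₃, hlt⟩ := hN
    replace hlt : ε < min ε₁ ε₂ := not_le.1 hlt
    have hder' := hder ε hε hε1 w hw hw₁ A hA hA' hZ
    have hLκ : (m + 1) * ε ^ (-lam) ≤ ε ^ (-(lam + κ)) := by
      rw [neg_add, add_comm (-lam), Real.rpow_add hε]
      have := hsmall₁ ε hε (hlt.trans_le (min_le_left _ _))
      have := Real.rpow_nonneg hε.le (-lam)
      gcongr
    have hpos : ∀ α : MultiIndex d (m + 1), α.1 ≠ 0 → ∀ t, |A α t| ≤ ε ^ (μ + κ) := by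
      intro α hα t
      obtain ⟨i, hi⟩ := Multiset.exists_mem_of_ne_zero hα
      have hcard : (α.1.erase i).card ≤ m := by
        rw [Multiset.card_erase_of_mem hi]
        exact Nat.pred_le_iff.2 α.2
      have h := hcoeff ε hε hε1 w hw hw₂ (derivCoeff A i)
        (fun β t => (abs_derivCoeff_le hA i β t).trans hLκ)
        (fun β s t => (abs_derivCoeff_sub_le hA' i β s t).trans (by gcongr))
        (hder' i) ⟨α.1.erase i, hcard⟩ t
      have e1 : (⟨i ::ₘ α.1.erase i, by
          rw [Multiset.cons_erase hi]; exact α.2⟩ : MultiIndex d (m + 1)) = α :=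
        Subtype.ext (Multiset.cons_erase hi)
      simp only [derivCoeff] at h
      rw [e1, abs_mul, abs_of_nonneg (by positivity)] at h
      exact (le_mul_of_one_le_left (abs_nonneg _)
        (le_add_of_nonneg_left (Nat.cast_nonneg _))).trans h
    intro α t
    by_cases hα : α.1 = 0
    · have hK1 : 1 ≤ ε ^ (-(κ / 2 / (m + 1))) := one_le_rpow_neg hε hε1 (by positivity)
      have h := abs_coeff_empty_le hK1 (hsup ε hε hε1 w hw hw₃) t (hZ t) (fun β hβ => hpos β hβ t)
        (Real.rpow_nonneg hε.le _) hα
      have e2 : ε ^ (μ + κ) * (ε ^ (-(κ / 2 / (m + 1)))) ^ (m + 1) = ε ^ (μ + κ / 2) := by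
        rw [← Real.rpow_natCast, ← Real.rpow_mul hε.le, ← Real.rpow_add hε]
        congr 1
        push_cast
        field_simp
        ring
      rw [e2] at h
      calc |A α t| ≤ ε ^ (μ + κ / 2)
            + (Fintype.card (MultiIndex d (m + 1)) : ℕ) * ε ^ (μ + κ / 2) := by
            refine h.trans (add_le_add_left ?_ _)
            exact Real.rpow_le_rpow_of_exponent_ge hε hε1 hμe
        _ = (1 + (Fintype.card (MultiIndex d (m + 1)) : ℕ)) * ε ^ (μ + κ / 2) := by ring
        _ ≤ ε ^ (-(κ / 2)) * ε ^ (μ + κ / 2) := by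
            have := hsmall₂ ε hε (hlt.trans_le (min_le_right _ _))
            have := Real.rpow_nonneg hε.le (μ + κ / 2)
            gcongr
        _ = ε ^ μ := by rw [← Real.rpow_add hε]; congr 1; ring
    · exact (hpos α hα t).trans (Real.rpow_le_rpow_of_exponent_ge hε hε1 (by linarith))

lemma exists_forall_abs_le {ι : Type*} [Finite ι] [Nonempty ι] {A : ι → unitInterval → ℝ}
    (hA : ∀ α, Continuous (A α)) : ∃ α₀ t₀, ∀ α t, |A α t| ≤ |A α₀ t₀| := by
  have h : ∀ α, ∃ t₀, ∀ t, |A α t| ≤ |A α t₀| := fun α => by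
    obtain ⟨t₀, -, ht₀⟩ := isCompact_univ.exists_isMaxOn (s := (Set.univ : Set unitInterval))
      Set.univ_nonempty (hA α).abs.continuousOn
    exact ⟨t₀, fun t => ht₀ (Set.mem_univ t)⟩
  choose τ hτ using h
  obtain ⟨α₀, hα₀⟩ := Finite.exists_max fun α => |A α (τ α)|
  exact ⟨α₀, τ α₀, fun α t => (hτ α t).trans (hα₀ α)⟩

lemma abs_sub_le_of_lipNorm_lt {f : unitInterval → ℝ} {L : ℝ}
    (h : lipNorm f < ENNReal.ofReal L) (s t : unitInterval) :
    |f s - f t| ≤ L * |(s : ℝ) - t| := by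
  have hmem : MemHolder 1 f := eHolderNorm_lt_top.1 (h.trans ENNReal.ofReal_lt_top)
  have hlip := holderWith_one.1 hmem.holderWith
  have hL : (nnHolderNorm 1 f : ℝ) ≤ L := by
    rw [lipNorm, ← hmem.coe_nnHolderNorm_eq_eHolderNorm] at h
    have hL0 : 0 < L := ENNReal.ofReal_pos.1 (bot_le.trans_lt h)
    rw [← ENNReal.ofReal_coe_nnreal] at h
    exact ((ENNReal.ofReal_lt_ofReal_iff hL0).1 h).le
  have hd := hlip.dist_le_mul s t
  rw [Real.dist_eq, Subtype.dist_eq, Real.dist_eq] at hd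
  exact hd.trans (by gcongr)

/-- The bound by `L` on the coefficients themselves in `exists_isNegligible_coeff_le` is
superfluous when `b < 1 ≤ L`: if it fails, scaling the coefficients down until their largest value
is exactly `L` keeps the other hypotheses and contradicts the conclusion. -/
lemma abs_coeff_le_of_scaling {d m : ℕ} {w : Fin d → unitInterval → ℝ} {L η b : ℝ} (hL : 1 ≤ L)
    (hb : b < 1)
    (H : ∀ A : MultiIndex d m → unitInterval → ℝ, (∀ α t, |A α t| ≤ L) →
      (∀ α (s t : unitInterval), |A α s - A α t| ≤ L * |(s : ℝ) - t|) →
      (∀ t, |wienerPolynomial w A t| ≤ η) → ∀ α t, |A α t| ≤ b)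
    {A : MultiIndex d m → unitInterval → ℝ} (hc : ∀ α, Continuous (A α))
    (hA' : ∀ α (s t : unitInterval), |A α s - A α t| ≤ L * |(s : ℝ) - t|)
    (hZ : ∀ t, |wienerPolynomial w A t| ≤ η) (α : MultiIndex d m) (t : unitInterval) :
    |A α t| ≤ b := by
  have : Nonempty (MultiIndex d m) := ⟨⟨0, by simp⟩⟩
  obtain ⟨α₀, t₀, hmax⟩ := exists_forall_abs_le hc
  rcases le_or_gt |A α₀ t₀| L with h | h
  · exact H A (fun α t => (hmax α t).trans h) hA' hZ α t
  exfalso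
  have hL0 : 0 < L := by linarith
  have hR : 0 < |A α₀ t₀| := hL0.trans h
  set c := L / |A α₀ t₀| with hc'
  have hc0 : 0 ≤ c := by positivity
  have hc1 : c ≤ 1 := (div_le_one hR).2 h.le
  have hsc := H (fun α t => c * A α t) ?_ ?_ ?_ α₀ t₀
  · rw [abs_mul, abs_of_nonneg hc0, hc', div_mul_cancel₀ _ hR.ne'] at hsc
    linarith
  · intro α t
    rw [abs_mul, abs_of_nonneg hc0]
    calc c * |A α t| ≤ c * |A α₀ t₀| := mul_le_mul_of_nonneg_left (hmax α t) hc0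
      _ = L := div_mul_cancel₀ _ hR.ne'
  · intro α s t
    rw [← mul_sub, abs_mul, abs_of_nonneg hc0]
    exact (mul_le_of_le_one_left (abs_nonneg _) hc1).trans (hA' α s t)
  · intro t
    have e : wienerPolynomial w (fun α t => c * A α t) t = c * wienerPolynomial w A t := by
      simp only [wienerPolynomial, Finset.mul_sum, mul_assoc]
    rw [e, abs_mul, abs_of_nonneg hc0]
    exact (mul_le_of_le_one_left (abs_nonneg _) hc1).trans (hZ t)

lemma abs_le_of_supNorm_le {f : unitInterval → ℝ} {b : ℝ} (hb : 0 ≤ b)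
    (h : supNorm f ≤ ENNReal.ofReal b) (t : unitInterval) : |f t| ≤ b := by
  have := (le_iSup (fun t => ‖f t‖ₑ) t).trans h
  rwa [Real.enorm_eq_ofReal_abs, ENNReal.ofReal_le_ofReal_iff hb] at this

lemma supNorm_le {f : unitInterval → ℝ} {b : ℝ} (h : ∀ t, |f t| ≤ b) :
    supNorm f ≤ ENNReal.ofReal b :=
  iSup_le fun t => by
    rw [Real.enorm_eq_ofReal_abs]
    exact ENNReal.ofReal_le_ofReal (h t)

/-- For `m ≥ 1` the exponents `e = 1`, `lam = 3 ^ (-(m + 1))`, `μ = 3 ^ (-m)` satisfy the strict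
inequality needed in `exists_isNegligible_coeff_le`. -/
lemma exponent_gap (m : ℕ) : ((3 : ℝ) ^ (m + 1))⁻¹
    < (1 + ((3 : ℝ) ^ (m + 1 + 1))⁻¹) / 2 ^ (m + 1) - ((3 : ℝ) ^ (m + 1 + 1))⁻¹ := by
  have h2 : (0 : ℝ) < 2 ^ m := by positivity
  have h3 : (0 : ℝ) < 3 ^ m := by positivity
  have h23 : (2 : ℝ) ^ m ≤ 3 ^ m := by gcongr; norm_num
  have e : (1 + ((3 : ℝ) ^ (m + 1 + 1))⁻¹) / 2 ^ (m + 1) - ((3 : ℝ) ^ (m + 1 + 1))⁻¹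
      - ((3 : ℝ) ^ (m + 1))⁻¹ = (9 * 3 ^ m + 1 - 8 * 2 ^ m) / (18 * 3 ^ m * 2 ^ m) := by
    simp only [pow_succ]
    field_simp
    ring
  have : 0 < (9 * 3 ^ m + 1 - 8 * 2 ^ m : ℝ) / (18 * 3 ^ m * 2 ^ m) :=
    div_pos (by linarith) (by positivity)
  linarith

end Induction

/-! ### The coefficient bound with exponents `3 ^ (-m)` -/

/-- The events are sets `N ε` of paths on `[0, 1]`, measurable for the product σ-algebra; they are
chosen before the probability space, the Wiener process and the coefficients. -/
theorem proposition1 (d m : ℕ) :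
    ∃ N : ℝ → Set (Fin d → unitInterval → ℝ),
      (∀ ε : ℝ, MeasurableSet (N ε)) ∧
      (∀ p : ℝ, 0 < p → ∃ C : ℝ,
        ∀ (Ω : Type*) [MeasurableSpace Ω] (P : Measure Ω) [IsProbabilityMeasure P]
          (W : Fin d → ℝ≥0 → Ω → ℝ), IsWienerProcess W P →
          ∀ ε : ℝ, 0 < ε → ε ≤ 1 →
            P {ω | pathOn W ω ∈ N ε} ≤ ENNReal.ofReal (C * ε ^ p)) ∧
      (∀ ε : ℝ, 0 < ε → ε ≤ 1 →
        ∀ w : Fin d → unitInterval → ℝ, (∀ i, Continuous (w i)) → w ∉ N ε →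
          ∀ A : MultiIndex d m → unitInterval → ℝ, (∀ α, ∃ K : ℝ≥0, LipschitzWith K (A α)) →
            supNorm (wienerPolynomial w A) ≤ ENNReal.ofReal ε →
              (⨆ α, supNorm (A α)) ≤ ENNReal.ofReal (ε ^ ((3 : ℝ) ^ m)⁻¹) ∨
              ENNReal.ofReal (ε ^ (-((3 : ℝ) ^ (m + 1))⁻¹)) ≤ ⨆ α, lipNorm (A α)) := by
  cases m with
  | zero =>
    -- In degree `0` the polynomial is its only coefficient, and there is no exceptional event.
    refine ⟨fun _ => ∅, fun _ => MeasurableSet.empty, fun p _ => ⟨0, by simp⟩,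
      fun ε hε _ w _ _ A _ hZ => Or.inl (iSup_le fun α => supNorm_le fun t => ?_)⟩
    rw [pow_zero, inv_one, Real.rpow_one, ← wienerPolynomial_degree_zero w A α t]
    exact abs_le_of_supNorm_le hε.le hZ t
  | succ m =>
    have hlam : 0 < ((3 : ℝ) ^ (m + 1 + 1))⁻¹ := by positivity
    obtain ⟨N, hN, hcoeff⟩ := exists_isNegligible_coeff_le d (m + 1) 1 ((3 : ℝ) ^ (m + 1 + 1))⁻¹
      ((3 : ℝ) ^ (m + 1))⁻¹ (by linarith) (exponent_gap m)
    have hN' := hN.union (isNegligible_large (ε₀ := 1) one_pos)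
    -- Discarding all paths at `ε = 1` makes `ε ^ (3 ^ (-m)) < 1` available for the rescaling.
    refine ⟨_, hN'.1, hN'.2, fun ε hε hε1 w hw hwN A hA hZ => ?_⟩
    rw [Set.mem_union, not_or] at hwN
    have hlt : ε < 1 := not_le.1 hwN.2
    rw [or_iff_not_imp_right, not_le]
    intro hlip
    have hlip' : ∀ α, lipNorm (A α) < ENNReal.ofReal (ε ^ (-((3 : ℝ) ^ (m + 1 + 1))⁻¹)) :=
      fun α => (le_iSup (fun α => lipNorm (A α)) α).trans_lt hlip
    refine iSup_le fun α => supNorm_le fun t => ?_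
    refine abs_coeff_le_of_scaling (one_le_rpow_neg hε hε1 hlam.le)
      (Real.rpow_lt_one hε.le hlt (by positivity)) (hcoeff ε hε hε1 w hw hwN.1)
      (fun α => (hA α).choose_spec.continuous) (fun α => abs_sub_le_of_lipNorm_lt (hlip' α))
      (fun t => ?_) α t
    rw [Real.rpow_one]
    exact abs_le_of_supNorm_le hε.le hZ t
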